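/- Let $(X,d)$ be a nonempty metric space with a Borel measure $\mu$ such that, with $V(x,r):=\mu(B(x,r))$, one has $0<V(x,r)<\infty$ for all $x\in X$, $r>0$, and suppose that $X$ is doubling: there is $C\ge 1$ with $V(x,2r)\le C\,V(x,r)$ for all $x\in X$, $r>0$. Let $X^+:=X\times(0,\infty)$ carry the measure $d\mu(y)\,\frac{dt}{t}$, and let $L^0(X^+)$ be the space of complex measurable functions on $X^+$ modulo almost everywhere equality. Put $\Gamma(x):=\{(y,t)\in X^+: y\in B(x,t)\}$ for $x\in X$, $T(B):=\{(y,t)\in X^+: B(y,t)\subset B\}$ for a ball $B\subset X$, and $(V^{r}f)(y,t):=V(y,t)^{r}f(y,t)$ for $r\in\mathbb R$. For $0<p,q<\infty$ and $s\in\mathbb R$ let $T^{p,q}_s$ be the space of $f\in L^0(X^+)$ with $$\|f\|_{T^{p,q}_s}:=\Big(\int_X\Big(\iint_{\Gamma(x)}|V^{-s}f(y,t)|^q\,\frac{d\mu(y)}{V(y,t)}\frac{dt}{t}\Big)^{p/q}d\mu(x)\Big)^{1/p}<\infty .$$ For $0<q<\infty$ and $s,\alpha\in\mathbb R$ let $T^{\infty,q}_{s;\alpha}$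 be the space of $f\in L^0(X^+)$ with $$\|f\|_{T^{\infty,q}_{s;\alpha}}:=\operatorname*{ess\,sup}_{x\in X}\ \sup_{B\ni x}\frac1{\mu(B)^{\alpha}}\Big(\frac1{\mu(B)}\iint_{T(B)}|V^{-s}f(y,t)|^q\,d\mu(y)\frac{dt}{t}\Big)^{1/q}<\infty ,$$ the supremum being over all balls $B$ containing $x$; for $q=\infty$ the inner expression is replaced by $\mu(B)^{-\alpha}\operatorname{ess\,sup}_{T(B)}|V^{-s}f|$. Theorem. Let $p\in(0,1)$, $q\in[1,\infty)$, $\frac1q+\frac1{q'}=1$ (so $q'=\infty$ if $q=1$), and $s\in\mathbb R$. Then the $L^2(X^+)$ inner product $$\langle f,g\rangle:=\iint_{X^+}f(x,t)\,\overline{g(x,t)}\,d\mu(x)\frac{dt}{t}$$ identifies the dual of $T^{p,q}_s$ with $T^{\infty,q'}_{-s;\,1/p-1}$. That is: the integral converges absolutely for all $f\in T^{p,q}_s$ and $g\in T^{\infty,q'}_{-s;1/p-1}$; the map $g\mapsto\langle\,\cdot\,,g\rangle$ is a conjugate-linear bijection from $T^{\infty,q'}_{-s;1/p-1}$ onto the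 space of bounded linear functionals on $T^{p,q}_s$; and there is a finite constant $C$ such that $$\|\langle\,\cdot\,,g\rangle\|\le C\,\|g\|_{T^{\infty,q'}_{-s;1/p-1}}\quad\text{and}\quad \|g\|_{T^{\infty,q'}_{-s;1/p-1}}\le C\,\|\langle\,\cdot\,,g\rangle\|$$ for all $g\in T^{\infty,q'}_{-s;1/p-1}$, where $\|\varphi\|:=\sup\{|\varphi(f)|:\|f\|_{T^{p,q}_s}\le1\}$. -/

import Mathlib

open MeasureTheory Set Metric
open scoped ENNReal NNReal ComplexConjugate

noncomputable section

namespace TentSpace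

variable {X : Type*} [MetricSpace X] [MeasurableSpace X]

/-- Nondegeneracy of a metric measure space: `0 < V(x,r) < ∞` for all `x` and all `r > 0`. -/
class Nondegenerate (μ : Measure X) : Prop where
  pos : ∀ (x : X) (r : ℝ), 0 < r → 0 < μ (ball x r)
  lt_top : ∀ (x : X) (r : ℝ), 0 < r → μ (ball x r) < ∞

/-- The doubling condition `V(x,2r) ≤ C V(x,r)`. -/
def Doubling (μ : Measure X) : Prop :=
  ∃ C : ℝ≥0, 1 ≤ C ∧ ∀ (x : X) (r : ℝ), 0 < r → μ (ball x (2 * r)) ≤ C * μ (ball x r)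

/-- The measure `dμ(y) dt/t` of the half-space `X⁺ = X × (0,∞)`. It is carried by `X × ℝ` and gives
no mass to `{t ≤ 0}`, so that functions on `X × ℝ` modulo almost everywhere equality are functions
on `X⁺` modulo almost everywhere equality. -/
def halfMeasure (μ : Measure X) : Measure (X × ℝ) :=
  μ.prod ((volume.restrict (Ioi (0 : ℝ))).withDensity fun t => ENNReal.ofReal t⁻¹)

/-- `L⁰(X⁺)`: complex measurable functions on the half-space, modulo almost everywhere equality. -/
abbrev L0 (μ : Measure X) : Type _ := (X × ℝ) →ₘ[halfMeasure μ] ℂ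

/-- The cone `Γ(x) = {(y,t) : y ∈ B(x,t)}`; its points have `t > 0` automatically. -/
def cone (x : X) : Set (X × ℝ) := {z | z.1 ∈ ball x z.2}

/-- The tent `T(B) = {(y,t) ∈ X⁺ : B(y,t) ⊆ B}`. -/
def tent (B : Set X) : Set (X × ℝ) := {z | 0 < z.2 ∧ ball z.1 z.2 ⊆ B}

/-- The operator `(V^s f)(y,t) = V(y,t)^s f(y,t)`. -/
def volPow (μ : Measure X) (s : ℝ) (f : X × ℝ → ℂ) : X × ℝ → ℂ :=
  fun z => ((μ.real (ball z.1 z.2) ^ s : ℝ) : ℂ) * f z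

/-- The measure `V(y,t)⁻¹ dμ(y) dt/t` on the half-space. -/
def coneMeasure (μ : Measure X) : Measure (X × ℝ) :=
  (halfMeasure μ).withDensity fun z => (μ (ball z.1 z.2))⁻¹

/-- The Lusin functional `A^q f(x)`, that is `(∬_{Γ(x)} |f(y,t)|^q V(y,t)⁻¹ dμ(y) dt/t)^{1/q}` for
`0 < q < ∞` and the essential supremum of `|f|` on `Γ(x)` for `q = ∞`. -/
def lusin (μ : Measure X) (q : ℝ≥0∞) (f : X × ℝ → ℂ) (x : X) : ℝ≥0∞ :=
  eLpNorm f q ((coneMeasure μ).restrict (cone x))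

/-- The Carleson functional: `C^q_α f(x)` is the supremum over all balls `B ∋ x` of
`μ(B)^{-α} (μ(B)⁻¹ ∬_{T(B)} |f(y,t)|^q dμ(y) dt/t)^{1/q}` for `0 < q < ∞`, and of
`μ(B)^{-α} ess sup_{T(B)} |f|` for `q = ∞`. -/
def carleson (μ : Measure X) (q : ℝ≥0∞) (α : ℝ) (f : X × ℝ → ℂ) (x : X) : ℝ≥0∞ :=
  ⨆ (c : X) (r : ℝ) (_ : 0 < r) (_ : x ∈ ball c r),
    μ (ball c r) ^ (-α) *
      eLpNorm f q ((μ (ball c r))⁻¹ • (halfMeasure μ).restrict (tent (ball c r)))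

/-- The quasi-norm `‖f‖_{T^{p,q}_s} = ‖A^q (V^{-s} f)‖_{L^p(X)}`. -/
def tentNorm (μ : Measure X) (p q : ℝ≥0∞) (s : ℝ) (f : L0 μ) : ℝ≥0∞ :=
  eLpNorm (lusin μ q (volPow μ (-s) f)) p μ

/-- The quasi-norm `‖f‖_{T^{∞,q}_{s;α}} = ‖C^q_α (V^{-s} f)‖_{L^∞(X)}`. -/
def carlesonNorm (μ : Measure X) (q : ℝ≥0∞) (s α : ℝ) (f : L0 μ) : ℝ≥0∞ :=
  eLpNorm (carleson μ q α (volPow μ (-s) f)) ∞ μ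

/-! ### Facts that make the two spaces linear subspaces of `L⁰(X⁺)` -/

theorem volPow_add {μ : Measure X} (s : ℝ) (f g : L0 μ) :
    volPow μ s ⇑(f + g) =ᵐ[halfMeasure μ] volPow μ s f + volPow μ s g := by
  filter_upwards [AEEqFun.coeFn_add f g] with z hz
  simp only [volPow, hz, Pi.add_apply, mul_add]

theorem volPow_smul {μ : Measure X} (s : ℝ) (c : ℂ) (f : L0 μ) :
    volPow μ s ⇑(c • f) =ᵐ[halfMeasure μ] c • volPow μ s f := by
  filter_upwards [AEEqFun.coeFn_smul c f] with z hz
  simp only [volPow, hz, Pi.smul_apply, smul_eq_mul]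
  ring

theorem volPow_zero {μ : Measure X} (s : ℝ) :
    volPow μ s ⇑(0 : L0 μ) =ᵐ[halfMeasure μ] 0 := by
  filter_upwards [AEEqFun.coeFn_zero (α := X × ℝ) (β := ℂ) (μ := halfMeasure μ)] with z hz
  simp [volPow, hz]

theorem restrict_coneMeasure_ac (μ : Measure X) (x : X) :
    (coneMeasure μ).restrict (cone x) ≪ halfMeasure μ :=
  Measure.restrict_le_self.absolutelyContinuous.trans (withDensity_absolutelyContinuous _ _)

theorem smul_restrict_ac {Ω : Type*} [MeasurableSpace Ω] (m : Measure Ω) (a : ℝ≥0∞) (S : Set Ω) :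
    a • m.restrict S ≪ m :=
  Measure.smul_absolutelyContinuous.trans Measure.restrict_le_self.absolutelyContinuous

theorem lusin_congr {μ : Measure X} {q : ℝ≥0∞} {f g : X × ℝ → ℂ} (h : f =ᵐ[halfMeasure μ] g) :
    lusin μ q f = lusin μ q g :=
  funext fun x => eLpNorm_congr_ae ((restrict_coneMeasure_ac μ x).ae_eq h)

theorem carleson_congr {μ : Measure X} {q : ℝ≥0∞} {α : ℝ} {f g : X × ℝ → ℂ}
    (h : f =ᵐ[halfMeasure μ] g) : carleson μ q α f = carleson μ q α g := by
  funext x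
  refine iSup_congr fun c => iSup_congr fun r => iSup_congr fun _ => iSup_congr fun _ => ?_
  rw [eLpNorm_congr_ae ((smul_restrict_ac (halfMeasure μ) _ _).ae_eq h)]

/-- Continuity from below of `L^q` norms along an increasing sequence of sets. -/
theorem exists_lt_eLpNorm_restrict {Ω : Type*} [MeasurableSpace Ω] (m : Measure Ω) (q : ℝ≥0∞)
    (f : Ω → ℂ) (S : ℕ → Set Ω) (hS : Monotone S) (a : ℝ≥0∞)
    (h : a < eLpNorm f q (m.restrict (⋃ n, S n))) :
    ∃ n, a < eLpNorm f q (m.restrict (S n)) := by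
  by_contra! hle
  refine absurd h (not_lt.2 ?_)
  rcases eq_or_ne q 0 with rfl | hq0
  · simp
  rcases eq_or_ne q ∞ with rfl | hq
  · rw [eLpNorm_exponent_top]
    refine essSup_le_of_ae_le a ?_
    refine (ae_restrict_iUnion_iff S _).2 fun n => ?_
    have := hle n
    rw [eLpNorm_exponent_top] at this
    filter_upwards [ae_le_eLpNormEssSup (f := f) (μ := m.restrict (S n))] with z hz
    exact hz.trans this
  · have hq' : 0 < q.toReal := ENNReal.toReal_pos hq0 hq
    simp only [eLpNorm_eq_lintegral_rpow_enorm_toReal hq0 hq, one_div] at hle ⊢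
    rw [setLIntegral_iUnion_of_directed _ hS.directed_le, ENNReal.rpow_inv_le_iff hq']
    exact iSup_le fun n => (ENNReal.rpow_inv_le_iff hq').1 (hle n)

theorem lowerSemicontinuous_lusin (μ : Measure X) (q : ℝ≥0∞) (f : X × ℝ → ℂ) :
    LowerSemicontinuous (lusin μ q f) := by
  intro x a ha
  have hcone : cone x = ⋃ n : ℕ, {z : X × ℝ | dist z.1 x < z.2 - 1 / ((n : ℝ) + 1)} := by
    ext z
    simp only [cone, mem_ball, mem_ofPred_eq, mem_iUnion]
    constructor
    · intro h
      obtain ⟨n, hn⟩ := exists_nat_one_div_lt (sub_pos.2 h)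
      exact ⟨n, by linarith⟩
    · rintro ⟨n, hn⟩
      have : (0 : ℝ) < 1 / ((n : ℝ) + 1) := by positivity
      linarith
  rw [lusin, hcone] at ha
  obtain ⟨n, hn⟩ := exists_lt_eLpNorm_restrict _ q f _ (by
    intro m n hmn z hz
    have : 1 / ((n : ℝ) + 1) ≤ 1 / ((m : ℝ) + 1) := by gcongr
    simp only [mem_ofPred_eq] at hz ⊢
    linarith) a ha
  filter_upwards [ball_mem_nhds x (show (0 : ℝ) < 1 / ((n : ℝ) + 1) by positivity)] with x' hx'
  refine hn.trans_le (eLpNorm_mono_measure _ (Measure.restrict_mono ?_ le_rfl))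
  intro z hz
  simp only [cone, mem_ball, mem_ofPred_eq] at hz hx' ⊢
  have := dist_triangle z.1 x x'
  rw [dist_comm x x'] at this
  linarith

theorem sigmaFinite_of_nondegenerate (μ : Measure X) [hμ : Nondegenerate μ] : SigmaFinite μ := by
  rcases isEmpty_or_nonempty X with h | ⟨⟨x₀⟩⟩
  · rw [Measure.eq_zero_of_isEmpty μ]; infer_instance
  · exact ⟨⟨⟨fun n => ball x₀ (n + 1), fun _ => trivial,
      fun n => hμ.lt_top x₀ _ (by positivity), by
        refine eq_univ_of_forall fun x => mem_iUnion.2 ?_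
        obtain ⟨n, hn⟩ := exists_nat_gt (dist x x₀)
        exact ⟨n, by rw [mem_ball]; linarith⟩⟩⟩⟩

theorem secondCountable_of_nondegenerate [BorelSpace X] (μ : Measure X) [hμ : Nondegenerate μ] :
    SecondCountableTopology X := by
  have := sigmaFinite_of_nondegenerate μ
  refine Metric.secondCountable_of_almost_dense_set fun ε hε => ?_
  obtain ⟨N, hN⟩ : ∃ N, Maximal (fun N : Set X => N.Pairwise fun x y => ε < dist x y) N := by
    refine zorn_subset _ fun c hc hchain => ⟨⋃₀ c, ?_, fun s hs => subset_sUnion_of_mem hs⟩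
    exact (pairwise_sUnion hchain.directedOn).2 fun s hs => hc hs
  refine ⟨N, ?_, fun x => ?_⟩
  · have h := Measure.countable_meas_pos_of_disjoint_iUnion (μ := μ)
      (As := fun x : N => ball (x : X) (ε / 2)) (fun _ => measurableSet_ball) (by
        intro x y hxy
        refine ball_disjoint_ball ?_
        have := hN.1 x.2 y.2 (fun h => hxy (Subtype.ext h))
        linarith)
    have h' : {i : N | 0 < μ (ball (i : X) (ε / 2))} = univ :=
      eq_univ_of_forall fun i => hμ.pos _ _ (by positivity)
    rw [h'] at h
    exact countable_coe_iff.1 (countable_univ_iff.1 h)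
  · by_contra! hx
    have hins : (insert x N).Pairwise fun x y => ε < dist x y := by
      refine hN.1.insert fun y hy _ => ⟨hx y hy, ?_⟩
      rw [dist_comm]; exact hx y hy
    have hxN : x ∈ N := hN.2 hins (subset_insert x N) (mem_insert x N)
    have := hx x hxN
    rw [dist_self] at this
    linarith

theorem measurable_volume_ball [BorelSpace X] (μ : Measure X) [Nondegenerate μ] :
    Measurable fun z : X × ℝ => μ (ball z.1 z.2) := by
  have := sigmaFinite_of_nondegenerate μ
  have := secondCountable_of_nondegenerate μ
  have hs : MeasurableSet {w : (X × ℝ) × X | dist w.2 w.1.1 < w.1.2} :=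
    measurableSet_lt (by fun_prop) (by fun_prop)
  exact measurable_measure_prodMk_left hs

theorem aestronglyMeasurable_volPow [BorelSpace X] {μ : Measure X} [Nondegenerate μ] (s : ℝ)
    (f : L0 μ) :
    AEStronglyMeasurable (volPow μ s f) (halfMeasure μ) := by
  have h : Measurable fun z : X × ℝ => ((μ.real (ball z.1 z.2) ^ s : ℝ) : ℂ) :=
    Complex.measurable_ofReal.comp ((measurable_volume_ball μ).ennreal_toReal.pow_const s)
  exact h.aestronglyMeasurable.mul f.aestronglyMeasurable

theorem tentNorm_add_le [BorelSpace X] {μ : Measure X} [Nondegenerate μ] (p q : ℝ≥0∞) (s : ℝ)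
    (f g : L0 μ) :
    tentNorm μ p q s (f + g) ≤
      ENNReal.LpAddConst q * (ENNReal.LpAddConst p * (tentNorm μ p q s f + tentNorm μ p q s g)) := by
  have hm : ∀ f : L0 μ, AEStronglyMeasurable (lusin μ q (volPow μ (-s) f)) μ := fun f =>
    (lowerSemicontinuous_lusin μ q _).measurable.aestronglyMeasurable
  have hC : ENNReal.LpAddConst q ≠ ∞ := (ENNReal.LpAddConst_lt_top q).ne
  refine le_trans ?_ (mul_le_mul_right (eLpNorm_add_le' (hm f) (hm g) p) _)
  rw [tentNorm, lusin_congr (volPow_add (-s) f g), ← ENNReal.coe_toNNReal hC]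
  refine eLpNorm_le_nnreal_smul_eLpNorm_of_ae_le_mul' (.of_forall fun x => ?_) p
  simp only [enorm_eq_self, Pi.add_apply, ENNReal.coe_toNNReal hC]
  exact eLpNorm_add_le'
    ((aestronglyMeasurable_volPow (-s) f).mono_ac (restrict_coneMeasure_ac μ x))
    ((aestronglyMeasurable_volPow (-s) g).mono_ac (restrict_coneMeasure_ac μ x)) q

theorem tentNorm_smul_le {μ : Measure X} (p q : ℝ≥0∞) (s : ℝ) (c : ℂ) (f : L0 μ) :
    tentNorm μ p q s (c • f) ≤ ‖c‖ₑ * tentNorm μ p q s f := by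
  rw [tentNorm, lusin_congr (volPow_smul (-s) c f)]
  refine eLpNorm_le_nnreal_smul_eLpNorm_of_ae_le_mul' (.of_forall fun x => ?_) p
  simp only [enorm_eq_self]
  exact eLpNorm_const_smul_le

theorem tentNorm_zero (μ : Measure X) (p q : ℝ≥0∞) (s : ℝ) : tentNorm μ p q s 0 = 0 := by
  have h : lusin μ q (volPow μ (-s) (0 : L0 μ)) = 0 := by
    rw [lusin_congr (volPow_zero (-s))]
    funext x
    simp [lusin]
  rw [tentNorm, h, eLpNorm_zero]

theorem carlesonNorm_add_le [BorelSpace X] {μ : Measure X} [Nondegenerate μ] (q : ℝ≥0∞)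
    (s α : ℝ) (f g : L0 μ) :
    carlesonNorm μ q s α (f + g) ≤
      ENNReal.LpAddConst q * (carlesonNorm μ q s α f + carlesonNorm μ q s α g) := by
  have hC : ENNReal.LpAddConst q ≠ ∞ := (ENNReal.LpAddConst_lt_top q).ne
  simp only [carlesonNorm, eLpNorm_exponent_top]
  refine le_trans ?_ (mul_le_mul_right (eLpNormEssSup_add_le (μ := μ)
    (f := carleson μ q α (volPow μ (-s) f)) (g := carleson μ q α (volPow μ (-s) g))) _)
  rw [carleson_congr (volPow_add (-s) f g), ← ENNReal.coe_toNNReal hC]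
  simp only [← eLpNorm_exponent_top]
  refine eLpNorm_le_nnreal_smul_eLpNorm_of_ae_le_mul' (.of_forall fun x => ?_) ∞
  simp only [enorm_eq_self, Pi.add_apply, ENNReal.coe_toNNReal hC]
  refine iSup_le fun c => iSup_le fun r => iSup_le fun hr => iSup_le fun hx => ?_
  have hle : ∀ h : X × ℝ → ℂ, μ (ball c r) ^ (-α) *
      eLpNorm h q ((μ (ball c r))⁻¹ • (halfMeasure μ).restrict (tent (ball c r))) ≤
        carleson μ q α h x := fun h =>
    le_iSup_of_le c (le_iSup_of_le r (le_iSup_of_le hr (le_iSup_of_le hx le_rfl)))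
  have hadd := eLpNorm_add_le'
    ((aestronglyMeasurable_volPow (-s) f).mono_ac
      (smul_restrict_ac (halfMeasure μ) (μ (ball c r))⁻¹ (tent (ball c r))))
    ((aestronglyMeasurable_volPow (-s) g).mono_ac
      (smul_restrict_ac (halfMeasure μ) (μ (ball c r))⁻¹ (tent (ball c r)))) q
  refine (mul_le_mul_right hadd _).trans ?_
  rw [mul_left_comm, mul_add]
  gcongr
  · exact hle _
  · exact hle _

theorem carlesonNorm_smul_le {μ : Measure X} (q : ℝ≥0∞) (s α : ℝ) (c : ℂ) (f : L0 μ) :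
    carlesonNorm μ q s α (c • f) ≤ ‖c‖ₑ * carlesonNorm μ q s α f := by
  rw [carlesonNorm, carleson_congr (volPow_smul (-s) c f)]
  refine eLpNorm_le_nnreal_smul_eLpNorm_of_ae_le_mul' (.of_forall fun x => ?_) ∞
  simp only [enorm_eq_self]
  refine iSup_le fun b => iSup_le fun r => iSup_le fun hr => iSup_le fun hx => ?_
  refine (mul_le_mul_right eLpNorm_const_smul_le _).trans ?_
  rw [mul_left_comm]
  refine mul_le_mul_right ?_ _
  exact le_iSup_of_le b (le_iSup_of_le r (le_iSup_of_le hr (le_iSup_of_le hx le_rfl)))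

theorem carlesonNorm_zero (μ : Measure X) (q : ℝ≥0∞) (s α : ℝ) : carlesonNorm μ q s α 0 = 0 := by
  have h : carleson μ q α (volPow μ (-s) (0 : L0 μ)) = 0 := by
    rw [carleson_congr (volPow_zero (-s))]
    funext x
    simp [carleson]
  rw [carlesonNorm, h, eLpNorm_zero]

/-! ### The spaces, the dual and the pairing -/

section Spaces

variable [BorelSpace X] (μ : Measure X) [Nondegenerate μ]

/-- The weighted tent space `T^{p,q}_s`. -/
def tentSpace (p q : ℝ≥0∞) (s : ℝ) : Submodule ℂ (L0 μ) where
  carrier := {f | tentNorm μ p q s f < ∞}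
  add_mem' {f g} hf hg := (tentNorm_add_le p q s f g).trans_lt
    (ENNReal.mul_lt_top (ENNReal.LpAddConst_lt_top q)
      (ENNReal.mul_lt_top (ENNReal.LpAddConst_lt_top p) (ENNReal.add_lt_top.2 ⟨hf, hg⟩)))
  zero_mem' := by simp [tentNorm_zero]
  smul_mem' c f hf := (tentNorm_smul_le p q s c f).trans_lt (ENNReal.mul_lt_top enorm_lt_top hf)

/-- The weighted Carleson-type space `T^{∞,q}_{s;α}`. -/
def carlesonSpace (q : ℝ≥0∞) (s α : ℝ) : Submodule ℂ (L0 μ) where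
  carrier := {f | carlesonNorm μ q s α f < ∞}
  add_mem' {f g} hf hg := (carlesonNorm_add_le q s α f g).trans_lt
    (ENNReal.mul_lt_top (ENNReal.LpAddConst_lt_top q) (ENNReal.add_lt_top.2 ⟨hf, hg⟩))
  zero_mem' := by simp [carlesonNorm_zero]
  smul_mem' c f hf := (carlesonNorm_smul_le q s α c f).trans_lt
    (ENNReal.mul_lt_top enorm_lt_top hf)

/-- The dual of the quasi-normed space `T^{p,q}_s`: the bounded linear functionals on it. -/
def tentDual (p q : ℝ≥0∞) (s : ℝ) : Submodule ℂ (Module.Dual ℂ (tentSpace μ p q s)) where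
  carrier := {φ | ∃ C : ℝ≥0, ∀ f : tentSpace μ p q s, ‖φ f‖ₑ ≤ C * tentNorm μ p q s f}
  add_mem' := by
    rintro φ ψ ⟨C, hC⟩ ⟨D, hD⟩
    refine ⟨C + D, fun f => ?_⟩
    rw [ENNReal.coe_add, add_mul]
    exact (enorm_add_le _ _).trans (add_le_add (hC f) (hD f))
  zero_mem' := ⟨0, fun f => by simp⟩
  smul_mem' := by
    rintro c φ ⟨C, hC⟩
    refine ⟨‖c‖₊ * C, fun f => ?_⟩
    rw [LinearMap.smul_apply, enorm_smul, ENNReal.coe_mul, mul_assoc]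
    exact mul_le_mul_right (hC f) _

variable {μ} in
/-- The dual norm `‖φ‖ = sup {|φ(f)| : ‖f‖_{T^{p,q}_s} ≤ 1}`. -/
def dualNorm {p q : ℝ≥0∞} {s : ℝ} (φ : tentDual μ p q s) : ℝ≥0∞ :=
  ⨆ (f : tentSpace μ p q s) (_ : tentNorm μ p q s f ≤ 1),
    ‖(φ : Module.Dual ℂ (tentSpace μ p q s)) f‖ₑ

end Spaces

/-- The `L²(X⁺)` inner product `⟨f,g⟩ = ∬ f(x,t) conj(g(x,t)) dμ(x) dt/t`. -/
def pairing (μ : Measure X) (f g : L0 μ) : ℂ := ∫ z, f z * conj (g z) ∂(halfMeasure μ)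

/-- `δ_{p,q} = 1/q - 1/p`, with `1/∞ = 0`. -/
def delta (p q : ℝ≥0∞) : ℝ := (1 / q).toReal - (1 / p).toReal

end TentSpace

end

open TentSpace

set_option linter.unusedSectionVars false

/-! Put F = V^{-s} f and G = V^s g. The weights cancel in the pairing, and because 1 - 1/q' = 1/q,
the Carleson norm of g is at most N exactly when the L^{q'} norm of G over T(B) is at most N
μ(B)^{1/p - 1/q} for every ball B (`carlesonNorm_le_iff`). Write A for the Lusin functional of F.

Upper bound. Sort the points (y,t) by the level k for which {A > 2^k} fills more than half of B(y,t)
but {A > 2^(k+1)} does not. On the k-th piece at least half of each ball lies where A ≤ 2^(k+1), so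
Tonelli over cones controls F in L^q on tents, and Hölder bounds the integral of |F G| over the part
of the piece in T(B) by a multiple of N 2^k μ(B)^{1/p}. A Vitali covering by tents over balls that
are half filled by {A > 2^k} adds these up: as 1/p ≥ 1, the sum of the powers is at most the power
of the sum, which gives N 2^k μ{A > 2^k}^{1/p} (`setLIntegral_level_le`). The same superadditivity
in k and a dyadic layer-cake sum give N ‖A‖_p (`lintegral_enorm_mul_le`).

Lower bound. A function carried by T(B) has T^{p,q} norm at most its L^q norm times μ(B)^{1/p -
1/q}. Testing the functional on such functions and applying the converse of Hölder's inequality on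
each tent bounds the Carleson norm by the norm of the functional, with constant 1.

Surjectivity. Choose w > 0 on the half-space with finite T^{p,q} norm. For a bounded functional φ,
the map h ↦ φ(V^s (h w)) on bounded functions h is continuous under bounded almost everywhere
convergence, hence is a complex measure with a density (`exists_integrable_representation`).
Dividing by w yields g, which represents φ on functions dominated by a multiple of w. This class
suffices for the lower bound, so g lies in the Carleson space; the upper bound and truncation then
extend the representation to the whole tent space. -/

namespace TentSpace

/-! ### Measurability on the half-space and Tonelli over cones -/

section Basic

variable {X : Type*} [MetricSpace X] [MeasurableSpace X] [BorelSpace X]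

theorem sigmaFinite_halfMeasure (μ : Measure X) [Nondegenerate μ] :
    SigmaFinite (halfMeasure μ) := by
  have := sigmaFinite_of_nondegenerate μ
  have : SigmaFinite ((volume.restrict (Ioi (0 : ℝ))).withDensity fun t => ENNReal.ofReal t⁻¹) :=
    SigmaFinite.withDensity_ofReal _
  unfold halfMeasure
  infer_instance

theorem ae_halfMeasure_pos (μ : Measure X) [Nondegenerate μ] :
    ∀ᵐ z ∂halfMeasure μ, 0 < z.2 := by
  have := sigmaFinite_of_nondegenerate μ
  have : SigmaFinite ((volume.restrict (Ioi (0 : ℝ))).withDensity fun t => ENNReal.ofReal t⁻¹) :=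
    SigmaFinite.withDensity_ofReal _
  have h : ∀ᵐ t ∂((volume.restrict (Ioi (0 : ℝ))).withDensity fun t => ENNReal.ofReal t⁻¹),
      0 < t :=
    (withDensity_absolutelyContinuous _ _).ae_le (ae_restrict_mem measurableSet_Ioi)
  exact Measure.quasiMeasurePreserving_snd.ae h

/-- Apart from t > 0 the condition on (y,t) is closed, for an arbitrary set `B`: it says t ≤ d(x,y)
for every x outside `B`. -/
theorem measurableSet_tent (μ : Measure X) [Nondegenerate μ] (B : Set X) :
    MeasurableSet (tent B) := by
  have := secondCountable_of_nondegenerate μ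
  have hcl : IsClosed {z : X × ℝ | ball z.1 z.2 ⊆ B} := by
    have h : {z : X × ℝ | ball z.1 z.2 ⊆ B} = ⋂ x ∈ Bᶜ, {z : X × ℝ | z.2 ≤ dist x z.1} := by
      ext z
      simp only [mem_ofPred_eq, mem_iInter, mem_compl_iff]
      constructor
      · intro h x hx
        by_contra! hlt
        exact hx (h hlt)
      · intro h x hx
        by_contra hB
        exact absurd hx (not_lt.2 (h x hB))
    rw [h]
    exact isClosed_biInter fun x _ => isClosed_le (by fun_prop) (by fun_prop)
  exact (measurableSet_lt measurable_const measurable_snd).inter hcl.measurableSet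

theorem measurableSet_cone (μ : Measure X) [Nondegenerate μ] (x : X) :
    MeasurableSet (cone x) := by
  have := secondCountable_of_nondegenerate μ
  exact measurableSet_lt (f := fun z : X × ℝ => dist z.1 x) (by fun_prop) (by fun_prop)

theorem mem_of_mem_cone_of_mem_tent {B : Set X} {x : X} {z : X × ℝ} (hz : z ∈ cone x)
    (hB : z ∈ tent B) : x ∈ B := by
  refine hB.2 ?_
  rw [mem_ball, dist_comm]
  exact hz

theorem measurable_volume_ball_inter (μ : Measure X) [Nondegenerate μ] {S : Set X}
    (hS : MeasurableSet S) : Measurable fun z : X × ℝ => μ (ball z.1 z.2 ∩ S) := by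
  have := sigmaFinite_of_nondegenerate μ
  have := secondCountable_of_nondegenerate μ
  have hs : MeasurableSet {w : (X × ℝ) × X | dist w.2 w.1.1 < w.1.2 ∧ w.2 ∈ S} :=
    (measurableSet_lt (f := fun w : (X × ℝ) × X => dist w.2 w.1.1) (g := fun w => w.1.2)
      (by fun_prop) (by fun_prop)).inter (measurable_snd hS)
  exact measurable_measure_prodMk_left hs

variable {μ : Measure X} [hμ : Nondegenerate μ]

theorem measurable_volPow (s : ℝ) {f : X × ℝ → ℂ} (hf : Measurable f) :
    Measurable (volPow μ s f) := by
  have h : Measurable fun z : X × ℝ => ((μ.real (ball z.1 z.2) ^ s : ℝ) : ℂ) :=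
    Complex.measurable_ofReal.comp ((measurable_volume_ball μ).ennreal_toReal.pow_const s)
  exact h.mul hf

theorem enorm_volPow (s : ℝ) (f : X × ℝ → ℂ) {z : X × ℝ} (hz : 0 < z.2) :
    ‖volPow μ s f z‖ₑ = μ (ball z.1 z.2) ^ s * ‖f z‖ₑ := by
  have h0 := hμ.pos z.1 z.2 hz
  have h1 := hμ.lt_top z.1 z.2 hz
  have hpos : 0 < μ.real (ball z.1 z.2) := ENNReal.toReal_pos h0.ne' h1.ne
  rw [volPow, enorm_mul]
  congr 1
  rw [← ofReal_norm, Complex.norm_real, Real.norm_of_nonneg (by positivity),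
    ← ENNReal.ofReal_rpow_of_pos hpos, ofReal_measureReal h1.ne]

/-- The Tonelli theorem for integrals over cones. -/
theorem setLIntegral_lintegral_cone {H : X × ℝ → ℝ≥0∞} (hH : Measurable H) (S : Set X) :
    ∫⁻ x in S, ∫⁻ z in cone x, H z ∂coneMeasure μ ∂μ =
      ∫⁻ z, (μ (ball z.1 z.2))⁻¹ * H z * μ (ball z.1 z.2 ∩ S) ∂halfMeasure μ := by
  have := sigmaFinite_of_nondegenerate μ
  have := sigmaFinite_halfMeasure μ
  have := secondCountable_of_nondegenerate μ
  have hV : Measurable fun z : X × ℝ => (μ (ball z.1 z.2))⁻¹ := (measurable_volume_ball μ).inv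
  have h1 : ∀ x, ∫⁻ z in cone x, H z ∂coneMeasure μ =
      ∫⁻ z, (cone x).indicator (fun z => (μ (ball z.1 z.2))⁻¹ * H z) z ∂halfMeasure μ := by
    intro x
    rw [coneMeasure, setLIntegral_withDensity_eq_setLIntegral_mul _ hV hH
      (measurableSet_cone μ x), lintegral_indicator (measurableSet_cone μ x)]
    rfl
  simp only [h1]
  have hm : Measurable (Function.uncurry fun (x : X) (z : X × ℝ) =>
      (cone x).indicator (fun z => (μ (ball z.1 z.2))⁻¹ * H z) z) := by
    have hs : MeasurableSet {w : X × (X × ℝ) | dist w.2.1 w.1 < w.2.2} :=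
      measurableSet_lt (by fun_prop) (by fun_prop)
    exact ((hV.mul hH).comp (measurable_snd (α := X))).indicator hs
  rw [lintegral_lintegral_swap hm.aemeasurable]
  refine lintegral_congr fun z => ?_
  have : ∀ x, (cone x).indicator (fun z => (μ (ball z.1 z.2))⁻¹ * H z) z =
      (ball z.1 z.2).indicator (fun _ => (μ (ball z.1 z.2))⁻¹ * H z) x := by
    intro x
    have : z ∈ cone x ↔ x ∈ ball z.1 z.2 := by simp [cone, dist_comm]
    by_cases hx : x ∈ ball z.1 z.2
    · rw [indicator_of_mem (this.2 hx), indicator_of_mem hx]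
    · rw [indicator_of_notMem (mt this.1 hx), indicator_of_notMem hx]
  simp only [this]
  rw [lintegral_indicator measurableSet_ball, setLIntegral_const,
    Measure.restrict_apply measurableSet_ball]

theorem measurable_lusin (q : ℝ≥0∞) (F : X × ℝ → ℂ) : Measurable (lusin μ q F) :=
  (lowerSemicontinuous_lusin μ q F).measurable

theorem lusin_rpow {q : ℝ≥0∞} (hq0 : q ≠ 0) (hq : q ≠ ∞) (F : X × ℝ → ℂ) (x : X) :
    lusin μ q F x ^ q.toReal = ∫⁻ z in cone x, ‖F z‖ₑ ^ q.toReal ∂coneMeasure μ := by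
  have hq' : 0 < q.toReal := ENNReal.toReal_pos hq0 hq
  rw [lusin, eLpNorm_eq_lintegral_rpow_enorm_toReal hq0 hq, ← ENNReal.rpow_mul,
    one_div_mul_cancel hq'.ne', ENNReal.rpow_one]

/-- Each term is a_i · a_i^(r-1), and a_i^(r-1) is at most the (r-1)-th power of the total. With r =
1/p this is how p < 1 enters the upper bound. -/
theorem tsum_rpow_le_rpow_tsum {ι : Type*} (a : ι → ℝ≥0∞) {r : ℝ} (hr : 1 ≤ r) :
    ∑' i, a i ^ r ≤ (∑' i, a i) ^ r := by
  have h : ∀ b : ℝ≥0∞, b ^ r = b * b ^ (r - 1) := fun b => by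
    conv_rhs => rw [← ENNReal.rpow_one b, ← ENNReal.rpow_mul, one_mul]
    rw [← ENNReal.rpow_add_of_nonneg _ _ zero_le_one (by linarith)]
    ring_nf
  rw [h (∑' i, a i), ← ENNReal.tsum_mul_right]
  refine ENNReal.tsum_le_tsum fun i => ?_
  rw [h]
  gcongr
  exact ENNReal.le_tsum i

theorem volume_ball_pos_lt_top {z : X × ℝ} (hz : 0 < z.2) :
    μ (ball z.1 z.2) ≠ 0 ∧ μ (ball z.1 z.2) ≠ ∞ :=
  ⟨(hμ.pos _ _ hz).ne', (hμ.lt_top _ _ hz).ne⟩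

end Basic

/-! ### The upper bound: stopping levels and Vitali coverings by tents -/

section Upper

variable {X : Type*} [MetricSpace X] [MeasurableSpace X] [BorelSpace X]
  {μ : Measure X} [hμ : Nondegenerate μ]

/-- If at least half of `B(y,t)` lies in `{A^q F ≤ a}` for all `(y,t) ∈ E`, then `F` is controlled in
`L^q` on the intersection of `E` with a tent. -/
theorem setLIntegral_inter_tent_le {q : ℝ≥0∞} (hq0 : q ≠ 0) (hq : q ≠ ∞) {F : X × ℝ → ℂ}
    (hF : Measurable F) {a : ℝ≥0∞} {E : Set (X × ℝ)} (hE : MeasurableSet E)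
    (hEa : ∀ z ∈ E, μ (ball z.1 z.2) ≤ 2 * μ (ball z.1 z.2 ∩ {x | lusin μ q F x ≤ a})) {B : Set X}
    (hB : MeasurableSet B) :
    ∫⁻ z in E ∩ tent B, ‖F z‖ₑ ^ q.toReal ∂halfMeasure μ ≤ 2 * (a ^ q.toReal * μ B) := by
  set L := {x | lusin μ q F x ≤ a} with hL
  have hLm : MeasurableSet L := measurableSet_le (measurable_lusin q F) measurable_const
  have hET : MeasurableSet (E ∩ tent B) := hE.inter (measurableSet_tent μ B)
  set H : X × ℝ → ℝ≥0∞ := (E ∩ tent B).indicator fun z => ‖F z‖ₑ ^ q.toReal with hHdef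
  have hH : Measurable H := (hF.enorm.pow_const _).indicator hET
  calc ∫⁻ z in E ∩ tent B, ‖F z‖ₑ ^ q.toReal ∂halfMeasure μ
      = ∫⁻ z, H z ∂halfMeasure μ := (lintegral_indicator hET _).symm
    -- Tonelli over the cones with vertex in `L` produces the weight μ(B(y,t) ∩ L) / V(y,t), which
    -- is at least 1/2 on `E`.
    _ ≤ ∫⁻ z, 2 * ((μ (ball z.1 z.2))⁻¹ * H z * μ (ball z.1 z.2 ∩ L)) ∂halfMeasure μ := by
        refine lintegral_mono fun z => ?_
        by_cases hz : z ∈ E ∩ tent B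
        · obtain ⟨h0, h1⟩ := volume_ball_pos_lt_top (μ := μ) hz.2.1
          calc H z = (μ (ball z.1 z.2))⁻¹ * H z * μ (ball z.1 z.2) := by
                rw [mul_right_comm, ENNReal.inv_mul_cancel h0 h1, one_mul]
            _ ≤ (μ (ball z.1 z.2))⁻¹ * H z * (2 * μ (ball z.1 z.2 ∩ L)) := by
                gcongr
                exact hEa z hz.1
            _ = _ := by ring
        · simp only [hHdef, indicator_of_notMem hz, zero_le]
    _ = 2 * ∫⁻ x in L, ∫⁻ z in cone x, H z ∂coneMeasure μ ∂μ := by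
        rw [lintegral_const_mul' _ _ (by simp), setLIntegral_lintegral_cone hH L]
    _ ≤ 2 * ∫⁻ x in L, B.indicator (fun _ => a ^ q.toReal) x ∂μ := by
        refine mul_le_mul_right (setLIntegral_mono' hLm fun x hx => ?_) _
        by_cases hxB : x ∈ B
        · rw [indicator_of_mem hxB]
          calc ∫⁻ z in cone x, H z ∂coneMeasure μ
              ≤ ∫⁻ z in cone x, ‖F z‖ₑ ^ q.toReal ∂coneMeasure μ :=
                lintegral_mono fun z => indicator_le_self _ _ z
            _ = lusin μ q F x ^ q.toReal := (lusin_rpow hq0 hq F x).symm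
            _ ≤ a ^ q.toReal := ENNReal.rpow_le_rpow hx ENNReal.toReal_nonneg
        · rw [indicator_of_notMem hxB]
          -- A cone with vertex outside `B` does not meet the tent over `B`.
          refine le_of_eq ((setLIntegral_congr_fun (measurableSet_cone μ x) fun z hz => ?_).trans
            lintegral_zero)
          exact indicator_of_notMem (fun h => hxB (mem_of_mem_cone_of_mem_tent hz h.2)) _
    _ ≤ 2 * ∫⁻ x, B.indicator (fun _ => a ^ q.toReal) x ∂μ := by
        gcongr
        exact Measure.restrict_le_self
    _ = 2 * (a ^ q.toReal * μ B) := by rw [lintegral_indicator_const hB]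

theorem Doubling.exists_five (h : Doubling μ) :
    ∃ D : ℝ≥0, ∀ (x : X) (r : ℝ), 0 < r → μ (ball x (5 * r)) ≤ D * μ (ball x r) := by
  obtain ⟨C, -, hC⟩ := h
  refine ⟨C * (C * C), fun x r hr => ?_⟩
  calc μ (ball x (5 * r)) ≤ μ (ball x (2 * (2 * (2 * r)))) :=
        measure_mono (ball_subset_ball (by linarith))
    _ ≤ C * (C * (C * μ (ball x r))) := by
        refine (hC x _ (by positivity)).trans (mul_le_mul_right ?_ _)
        refine (hC x _ (by positivity)).trans (mul_le_mul_right ?_ _)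
        exact hC x _ hr
    _ = _ := by push_cast; ring

/-- A Vitali covering by tents. -/
theorem exists_countable_tent_cover (μ : Measure X) [Nondegenerate μ] (E : Set (X × ℝ))
    (hpos : ∀ z ∈ E, 0 < z.2) (R : ℝ)
    (hR : ∀ z ∈ E, z.2 ≤ R) :
    ∃ u ⊆ E, u.Countable ∧ u.PairwiseDisjoint (fun z => ball z.1 z.2) ∧
      E ⊆ ⋃ b ∈ u, tent (ball b.1 (5 * b.2)) := by
  have := secondCountable_of_nondegenerate μ
  obtain ⟨u, huE, hdisj, hcov⟩ := Vitali.exists_disjoint_subfamily_covering_enlargement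
    (fun z : X × ℝ => ball z.1 z.2) E (fun z => z.2) 2 one_lt_two (fun z hz => (hpos z hz).le) R hR
    (fun z hz => nonempty_ball.2 (hpos z hz))
  refine ⟨u, huE, hdisj.countable_of_isOpen (fun _ _ => isOpen_ball)
    (fun z hz => nonempty_ball.2 (hpos z (huE hz))), hdisj, fun z hz => ?_⟩
  obtain ⟨b, hb, ⟨x, hxz, hxb⟩, hle⟩ := hcov z hz
  -- The selected ball meets B(z) and has radius at least half that of B(z), so B(z) lies within 1 +
  -- 2 · 2 = 5 of its radii.
  refine mem_iUnion₂.2 ⟨b, hb, hpos z hz, fun y hy => ?_⟩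
  rw [mem_ball] at *
  have h1 := dist_triangle y z.1 b.1
  have h2 := dist_triangle z.1 x b.1
  rw [dist_comm z.1 x] at h2
  linarith

theorem lintegral_enorm_mul_le_eLpNorm {Ω : Type*} [MeasurableSpace Ω] (ν : Measure Ω)
    {q q' : ℝ≥0∞} (hqq' : 1 / q + 1 / q' = 1) {F G : Ω → ℂ} (hF : Measurable F)
    (hG : Measurable G) :
    ∫⁻ z, ‖F z‖ₑ * ‖G z‖ₑ ∂ν ≤ eLpNorm F q ν * eLpNorm G q' ν := by
  have : ENNReal.HolderTriple q q' 1 := ⟨by simpa using hqq'⟩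
  have h := eLpNorm_smul_le_mul_eLpNorm (μ := ν) (p := q) (q := q') (r := 1)
    hG.aestronglyMeasurable hF.aestronglyMeasurable
  rw [eLpNorm_one_eq_lintegral_enorm] at h
  simpa [enorm_mul] using h

/-- Over one tent T(B), Hölder multiplies a μ(B)^{1/q} by N μ(B)^{1/p - 1/q}, which leaves a N
μ(B)^{1/p}. Over a Vitali family of disjoint balls B_b with centres and radii in `E`, the measure of
5 B_b is at most 2 D μ(B_b ∩ O): `D` comes from doubling and 2 from `hEO`. Since 1/p ≥ 1 and the
sets B_b ∩ O are disjoint, the powers add up to at most μ(O)^{1/p}. -/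
theorem setLIntegral_level_le {D : ℝ≥0}
    (hD : ∀ (x : X) (r : ℝ), 0 < r → μ (ball x (5 * r)) ≤ D * μ (ball x r))
    {p q q' : ℝ≥0∞} (hp0 : 0 < p) (hp1 : p < 1) (hq1 : 1 ≤ q) (hq : q < ∞)
    (hqq' : 1 / q + 1 / q' = 1) {F G : X × ℝ → ℂ} (hF : Measurable F) (hG : Measurable G)
    {N : ℝ≥0∞} (hN : ∀ (c : X) (r : ℝ), 0 < r → eLpNorm G q' ((halfMeasure μ).restrict
      (tent (ball c r))) ≤ N * μ (ball c r) ^ (1 / p.toReal - 1 / q.toReal))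
    {a : ℝ≥0∞} {O : Set X} (hO : MeasurableSet O) {E : Set (X × ℝ)} (hE : MeasurableSet E)
    (hpos : ∀ z ∈ E, 0 < z.2)
    (hEO : ∀ z ∈ E, μ (ball z.1 z.2) ≤ 2 * μ (ball z.1 z.2 ∩ O))
    (hEa : ∀ z ∈ E, μ (ball z.1 z.2) ≤ 2 * μ (ball z.1 z.2 ∩ {x | lusin μ q F x ≤ a})) :
    ∫⁻ z in E, ‖F z‖ₑ * ‖G z‖ₑ ∂halfMeasure μ ≤
      2 * (2 * D) ^ (1 / p.toReal) * N * (a * μ O ^ (1 / p.toReal)) := by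
  have hq0 : q ≠ 0 := (zero_lt_one.trans_le hq1).ne'
  have hqr : 1 ≤ q.toReal := by
    simpa using (ENNReal.toReal_le_toReal (by simp) hq.ne).2 hq1
  have hpr : 0 < p.toReal := ENNReal.toReal_pos hp0.ne' (hp1.trans ENNReal.one_lt_top).ne
  have hpr1 : p.toReal < 1 := by
    simpa using (ENNReal.toReal_lt_toReal (hp1.trans ENNReal.one_lt_top).ne (by simp)).2 hp1
  have hP : 1 ≤ 1 / p.toReal := by rw [le_div_iff₀ hpr]; linarith
  have hQ : 1 / q.toReal ≤ 1 := by rw [div_le_iff₀ (by linarith)]; linarith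
  have hlocal : ∀ (c : X) (r : ℝ), 0 < r → ∫⁻ z in E ∩ tent (ball c r),
      ‖F z‖ₑ * ‖G z‖ₑ ∂halfMeasure μ ≤ 2 * N * a * μ (ball c r) ^ (1 / p.toReal) := by
    intro c r hr
    refine (lintegral_enorm_mul_le_eLpNorm _ hqq' hF hG).trans ?_
    have h1 : eLpNorm F q ((halfMeasure μ).restrict (E ∩ tent (ball c r))) ≤
        2 * (a * μ (ball c r) ^ (1 / q.toReal)) := by
      rw [eLpNorm_eq_lintegral_rpow_enorm_toReal hq0 hq.ne]
      refine (ENNReal.rpow_le_rpow (setLIntegral_inter_tent_le hq0 hq.ne hF hE hEa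
        measurableSet_ball) (by positivity)).trans ?_
      rw [ENNReal.mul_rpow_of_nonneg _ _ (by positivity),
        ENNReal.mul_rpow_of_nonneg _ _ (by positivity), ← ENNReal.rpow_mul,
        mul_one_div_cancel (by linarith), ENNReal.rpow_one]
      gcongr
      calc (2 : ℝ≥0∞) ^ (1 / q.toReal) ≤ 2 ^ (1 : ℝ) :=
            ENNReal.rpow_le_rpow_of_exponent_le (by norm_num) hQ
        _ = 2 := ENNReal.rpow_one _
    have h2 : eLpNorm G q' ((halfMeasure μ).restrict (E ∩ tent (ball c r))) ≤
        N * μ (ball c r) ^ (1 / p.toReal - 1 / q.toReal) :=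
      (eLpNorm_mono_measure _ (Measure.restrict_mono inter_subset_right le_rfl)).trans (hN c r hr)
    refine (mul_le_mul' h1 h2).trans (le_of_eq ?_)
    calc _ = 2 * N * a * (μ (ball c r) ^ (1 / q.toReal) *
          μ (ball c r) ^ (1 / p.toReal - 1 / q.toReal)) := by ring
      _ = _ := by
        rw [← ENNReal.rpow_add_of_nonneg _ _ (by positivity) (by linarith)]
        ring_nf
  -- The Vitali covering needs bounded radii; the bound does not depend on the truncation height, so
  -- monotone convergence removes it.
  have htrunc : ∀ n : ℕ, ∫⁻ z in E ∩ {z | z.2 ≤ n}, ‖F z‖ₑ * ‖G z‖ₑ ∂halfMeasure μ ≤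
      2 * (2 * D) ^ (1 / p.toReal) * N * (a * μ O ^ (1 / p.toReal)) := by
    intro n
    obtain ⟨u, huE, hu, hdisj, hcov⟩ := exists_countable_tent_cover μ (E ∩ {z | z.2 ≤ n})
      (fun z hz => hpos z hz.1) n (fun z hz => hz.2)
    have : Countable u := hu
    calc ∫⁻ z in E ∩ {z | z.2 ≤ n}, ‖F z‖ₑ * ‖G z‖ₑ ∂halfMeasure μ
        ≤ ∫⁻ z in ⋃ b : u, E ∩ tent (ball b.1.1 (5 * b.1.2)), ‖F z‖ₑ * ‖G z‖ₑ ∂halfMeasure μ := by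
          refine lintegral_mono_set fun z hz => ?_
          obtain ⟨b, hb, hzb⟩ := mem_iUnion₂.1 (hcov hz)
          exact mem_iUnion.2 ⟨⟨b, hb⟩, hz.1, hzb⟩
      _ ≤ ∑' b : u, ∫⁻ z in E ∩ tent (ball b.1.1 (5 * b.1.2)), ‖F z‖ₑ * ‖G z‖ₑ ∂halfMeasure μ :=
          lintegral_iUnion_le _ _
      _ ≤ ∑' b : u, 2 * N * a * (2 * D) ^ (1 / p.toReal) *
            μ (ball b.1.1 b.1.2 ∩ O) ^ (1 / p.toReal) := by
          refine ENNReal.tsum_le_tsum fun b => ?_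
          have hb := (huE b.2).1
          refine (hlocal b.1.1 (5 * b.1.2) (by linarith [hpos _ hb])).trans ?_
          rw [mul_assoc _ ((2 * (D : ℝ≥0∞)) ^ _), ← ENNReal.mul_rpow_of_nonneg _ _ (by positivity)]
          gcongr
          refine (hD _ _ (hpos _ hb)).trans ?_
          calc (D : ℝ≥0∞) * μ (ball b.1.1 b.1.2) ≤ D * (2 * μ (ball b.1.1 b.1.2 ∩ O)) := by
                gcongr
                exact hEO _ hb
            _ = _ := by ring
      _ ≤ 2 * N * a * (2 * D) ^ (1 / p.toReal) *
            (∑' b : u, μ (ball b.1.1 b.1.2 ∩ O)) ^ (1 / p.toReal) := by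
          rw [ENNReal.tsum_mul_left]
          gcongr
          exact tsum_rpow_le_rpow_tsum _ hP
      _ ≤ 2 * N * a * (2 * D) ^ (1 / p.toReal) * μ O ^ (1 / p.toReal) := by
          gcongr
          rw [← measure_iUnion]
          · exact measure_mono (iUnion_subset fun b => inter_subset_right)
          · intro b c hbc
            exact (hdisj b.2 c.2 (fun h => hbc (Subtype.ext h))).mono inter_subset_left
              inter_subset_left
          · exact fun b => measurableSet_ball.inter hO
      _ = _ := by ring
  have hunion : E = ⋃ n : ℕ, E ∩ {z | z.2 ≤ n} := by
    ext z
    simp only [mem_iUnion, mem_inter_iff, mem_ofPred_eq, exists_and_left]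
    exact ⟨fun h => ⟨h, exists_nat_ge _⟩, fun h => h.1⟩
  rw [hunion, setLIntegral_iUnion_of_directed]
  · exact iSup_le htrunc
  · refine Monotone.directed_le fun m n hmn z hz => ⟨hz.1, ?_⟩
    have : (m : ℝ) ≤ n := by exact_mod_cast hmn
    have h2 : z.2 ≤ m := hz.2
    exact h2.trans this

/-- If 2^j < a ≤ 2^(j+1), only the levels k = j - n contribute, and they form a geometric series of
ratio 2^(-p) whose leading term is at most a^p. -/
theorem tsum_zpow_indicator_le {p : ℝ} (hp : 0 < p) (a : ℝ≥0∞) :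
    ∑' k : ℤ, (if (2 : ℝ≥0∞) ^ k < a then ((2 : ℝ≥0∞) ^ k) ^ p else 0) ≤
      (1 - 2 ^ (-p))⁻¹ * a ^ p := by
  have hc0 : ((1 : ℝ≥0∞) - 2 ^ (-p))⁻¹ ≠ 0 :=
    ENNReal.inv_ne_zero.2 (ENNReal.sub_ne_top ENNReal.one_ne_top)
  rcases eq_or_ne a 0 with rfl | ha0
  · simp
  rcases eq_or_ne a ∞ with rfl | ha
  · rw [ENNReal.top_rpow_of_pos hp, ENNReal.mul_top hc0]
    exact le_top
  obtain ⟨j, hj, hj'⟩ := ENNReal.exists_mem_Ioc_zpow ha0 ha ENNReal.one_lt_two ENNReal.ofNat_ne_top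
  have hinj : Function.Injective fun n : ℕ => j - (n : ℤ) := fun m n h => by
    simp only at h; omega
  rw [← hinj.tsum_eq]
  · have hterm : ∀ n : ℕ, (if (2 : ℝ≥0∞) ^ (j - (n : ℤ)) < a then
        ((2 : ℝ≥0∞) ^ (j - (n : ℤ))) ^ p else 0) ≤ ((2 : ℝ≥0∞) ^ (-p)) ^ n * a ^ p := by
      intro n
      split_ifs with h
      · rw [ENNReal.zpow_sub (by simp) (by simp),
          ENNReal.mul_rpow_of_nonneg _ _ hp.le, mul_comm, ← ENNReal.rpow_natCast,
          ← ENNReal.rpow_mul]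
        gcongr
        rw [zpow_natCast, ← ENNReal.rpow_natCast, ← ENNReal.rpow_neg, ← ENNReal.rpow_mul]
        apply le_of_eq; ring_nf
      · simp
    refine (ENNReal.tsum_le_tsum hterm).trans ?_
    rw [ENNReal.tsum_mul_right, ENNReal.tsum_geometric]
  · intro k hk
    simp only [Function.mem_support, ne_eq, ite_eq_right_iff, not_forall] at hk
    obtain ⟨hk, -⟩ := hk
    have : k < j + 1 := by
      by_contra! h
      exact absurd (hk.trans_le hj') (not_lt.2 (ENNReal.zpow_le_of_le one_le_two h))
    exact ⟨(j - k).toNat, by simp only; omega⟩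

/-- A dyadic layer-cake formula: by Tonelli it reduces to the pointwise geometric series
`tsum_zpow_indicator_le`. -/
theorem tsum_zpow_rpow_mul_measure_le {p : ℝ} (hp : 0 < p) {A : X → ℝ≥0∞} (hA : Measurable A) :
    ∑' k : ℤ, ((2 : ℝ≥0∞) ^ k) ^ p * μ {x | (2 : ℝ≥0∞) ^ k < A x} ≤
      (1 - 2 ^ (-p))⁻¹ * ∫⁻ x, A x ^ p ∂μ := by
  have hm : ∀ k : ℤ, MeasurableSet {x | (2 : ℝ≥0∞) ^ k < A x} := fun k =>
    measurableSet_lt measurable_const hA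
  calc ∑' k : ℤ, ((2 : ℝ≥0∞) ^ k) ^ p * μ {x | (2 : ℝ≥0∞) ^ k < A x}
      = ∑' k : ℤ, ∫⁻ x, (if (2 : ℝ≥0∞) ^ k < A x then ((2 : ℝ≥0∞) ^ k) ^ p else 0) ∂μ := by
        refine tsum_congr fun k => ?_
        rw [← lintegral_indicator_const (hm k)]
        refine lintegral_congr fun x => ?_
        simp only [indicator_apply, mem_ofPred_eq]
    _ = ∫⁻ x, ∑' k : ℤ, (if (2 : ℝ≥0∞) ^ k < A x then ((2 : ℝ≥0∞) ^ k) ^ p else 0) ∂μ :=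
        (lintegral_tsum fun k => (Measurable.ite (hm k) measurable_const
          measurable_const).aemeasurable).symm
    _ ≤ ∫⁻ x, (1 - 2 ^ (-p))⁻¹ * A x ^ p ∂μ :=
        lintegral_mono fun x => tsum_zpow_indicator_le hp (A x)
    _ = _ := lintegral_const_mul _ (hA.pow_const p)

theorem measure_ball_le_two_mul_inter_of_compl {z : X × ℝ} (hz : 0 < z.2) {O : Set X}
    (hO : MeasurableSet O) (h : 2 * μ (ball z.1 z.2 ∩ O) ≤ μ (ball z.1 z.2)) :
    μ (ball z.1 z.2) ≤ 2 * μ (ball z.1 z.2 ∩ Oᶜ) := by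
  have hfin := (volume_ball_pos_lt_top (μ := μ) hz).2
  have hsplit := measure_inter_add_sdiff (μ := μ) (ball z.1 z.2) hO
  rw [sdiff_eq] at hsplit
  refine (ENNReal.add_le_add_iff_left hfin).1 ?_
  calc μ (ball z.1 z.2) + μ (ball z.1 z.2)
      = 2 * μ (ball z.1 z.2 ∩ O) + 2 * μ (ball z.1 z.2 ∩ Oᶜ) := by
        rw [← mul_add, hsplit, two_mul]
    _ ≤ _ := by gcongr

/-- Otherwise, by induction, every level set above `k` fills more than half of the ball. These sets
decrease to {A = ∞}, which is null, and continuity from above contradicts the positive finite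
measure of the ball. -/
theorem exists_mem_level_diff {A : X → ℝ≥0∞} (hA : Measurable A) (htop : ∀ᵐ x ∂μ, A x ≠ ∞)
    {z : X × ℝ} (hz : 0 < z.2) {k : ℤ}
    (hk : μ (ball z.1 z.2) < 2 * μ (ball z.1 z.2 ∩ {x | (2 : ℝ≥0∞) ^ k < A x})) :
    ∃ j : ℤ, μ (ball z.1 z.2) < 2 * μ (ball z.1 z.2 ∩ {x | (2 : ℝ≥0∞) ^ j < A x}) ∧
      2 * μ (ball z.1 z.2 ∩ {x | (2 : ℝ≥0∞) ^ (j + 1) < A x}) ≤ μ (ball z.1 z.2) := by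
  by_contra! hcon
  obtain ⟨h0, hfin⟩ := volume_ball_pos_lt_top (μ := μ) hz
  have hall : ∀ n : ℕ, μ (ball z.1 z.2) <
      2 * μ (ball z.1 z.2 ∩ {x | (2 : ℝ≥0∞) ^ (k + n) < A x}) := by
    intro n
    induction n with
    | zero => simpa using hk
    | succ n ih =>
      have := hcon _ ih
      rwa [add_assoc] at this
  set S : ℕ → Set X := fun n => ball z.1 z.2 ∩ {x | (2 : ℝ≥0∞) ^ (k + n) < A x} with hS
  have hanti : Antitone S := fun m n hmn x hx => ⟨hx.1,
    lt_of_le_of_lt (ENNReal.zpow_le_of_le one_le_two (by gcongr)) hx.2⟩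
  have hlim := hanti.measure_iInter (μ := μ) (fun n => (measurableSet_ball.inter
    (measurableSet_lt measurable_const hA)).nullMeasurableSet)
    ⟨0, ((measure_mono inter_subset_left).trans_lt hfin.lt_top).ne⟩
  have hzero : μ (⋂ n, S n) = 0 := by
    refine measure_mono_null (fun x hx => ?_) htop
    simp only [mem_compl_iff, mem_ofPred_eq, not_not]
    by_contra hne
    have hlt : ∀ n : ℕ, (2 : ℝ≥0∞) ^ k * 2 ^ n < A x := fun n => by
      have := (mem_iInter.1 hx n).2
      simpa [ENNReal.zpow_add] using this
    have hk0 : (2 : ℝ≥0∞) ^ k ≠ 0 := (ENNReal.zpow_pos (by simp) (by simp) k).ne'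
    have hk1 : (2 : ℝ≥0∞) ^ k ≠ ∞ := (ENNReal.zpow_lt_top (by simp) (by simp) k).ne
    obtain ⟨n, hn⟩ := ENNReal.exists_nat_gt (ENNReal.div_ne_top hne hk0)
    refine absurd (hlt n) (not_lt.2 ?_)
    rw [ENNReal.div_lt_iff (.inl hk0) (.inl hk1)] at hn
    refine hn.le.trans ?_
    rw [mul_comm]
    gcongr
    exact_mod_cast Nat.lt_two_pow_self.le
  rw [hzero] at hlim
  have hle : μ (ball z.1 z.2) / 2 ≤ ⨅ n, μ (S n) := le_iInf fun n => by
    rw [ENNReal.div_le_iff (by simp) (by simp), mul_comm]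
    exact (hall n).le
  rw [← hlim] at hle
  simp only [nonpos_iff_eq_zero, ENNReal.div_eq_zero_iff, ENNReal.ofNat_ne_top, or_false] at hle
  exact h0 hle

/-- The Carleson-type duality estimate. -/
theorem lintegral_enorm_mul_le {D : ℝ≥0}
    (hD : ∀ (x : X) (r : ℝ), 0 < r → μ (ball x (5 * r)) ≤ D * μ (ball x r))
    {p q q' : ℝ≥0∞} (hp0 : 0 < p) (hp1 : p < 1) (hq1 : 1 ≤ q) (hq : q < ∞)
    (hqq' : 1 / q + 1 / q' = 1) {F G : X × ℝ → ℂ} (hF : Measurable F) (hG : Measurable G)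
    {N : ℝ≥0∞} (hN : ∀ (c : X) (r : ℝ), 0 < r → eLpNorm G q' ((halfMeasure μ).restrict
      (tent (ball c r))) ≤ N * μ (ball c r) ^ (1 / p.toReal - 1 / q.toReal))
    (hfin : eLpNorm (lusin μ q F) p μ < ∞) :
    ∫⁻ z, ‖F z‖ₑ * ‖G z‖ₑ ∂halfMeasure μ ≤
      4 * (2 * D) ^ (1 / p.toReal) * ((1 - 2 ^ (-p.toReal))⁻¹) ^ (1 / p.toReal) * N *
        eLpNorm (lusin μ q F) p μ := by
  have hp : p ≠ ∞ := (hp1.trans ENNReal.one_lt_top).ne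
  have hpr : 0 < p.toReal := ENNReal.toReal_pos hp0.ne' hp
  have hpr1 : p.toReal < 1 := by
    simpa using (ENNReal.toReal_lt_toReal hp (by simp)).2 hp1
  have hP : 1 ≤ 1 / p.toReal := by rw [le_div_iff₀ hpr]; linarith
  set A := lusin μ q F with hAdef
  have hA : Measurable A := measurable_lusin q F
  have hnorm : eLpNorm A p μ = (∫⁻ x, A x ^ p.toReal ∂μ) ^ (1 / p.toReal) := by
    rw [eLpNorm_eq_lintegral_rpow_enorm_toReal hp0.ne' hp]
    simp only [enorm_eq_self]
  have hint : ∫⁻ x, A x ^ p.toReal ∂μ ≠ ∞ := by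
    intro h
    rw [hnorm, h, ENNReal.top_rpow_of_pos (by positivity)] at hfin
    exact lt_irrefl _ hfin
  have htop : ∀ᵐ x ∂μ, A x ≠ ∞ := by
    filter_upwards [ae_lt_top (hA.pow_const _) hint] with x hx h
    rw [h, ENNReal.top_rpow_of_pos hpr] at hx
    exact lt_irrefl _ hx
  set O : ℤ → Set X := fun k => {x | (2 : ℝ≥0∞) ^ k < A x} with hOdef
  have hO : ∀ k, MeasurableSet (O k) := fun k => measurableSet_lt measurable_const hA
  have hcompl : ∀ k, (O k)ᶜ = {x | A x ≤ (2 : ℝ≥0∞) ^ k} := fun k => by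
    ext x; simp [hOdef]
  set V : X × ℝ → ℝ≥0∞ := fun z => μ (ball z.1 z.2) with hV
  have hVm : Measurable V := measurable_volume_ball μ
  -- On `E k` the set `O k` fills more than half of the ball, while A ≤ 2^(k+1) on at least half of
  -- it: the two hypotheses of `setLIntegral_level_le`.
  set E : ℤ → Set (X × ℝ) := fun k => {z | 0 < z.2 ∧ V z < 2 * μ (ball z.1 z.2 ∩ O k) ∧
    2 * μ (ball z.1 z.2 ∩ O (k + 1)) ≤ V z} with hEdef
  have hE : ∀ k, MeasurableSet (E k) := fun k =>
    (measurableSet_lt measurable_const measurable_snd).inter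
      ((measurableSet_lt hVm ((measurable_volume_ball_inter μ (hO k)).const_mul 2)).inter
        (measurableSet_le ((measurable_volume_ball_inter μ (hO (k + 1))).const_mul 2) hVm))
  -- The remaining points: no level set fills more than half of the ball, so in the limit k → -∞
  -- neither does {A > 0}.
  set E' : Set (X × ℝ) := {z | 0 < z.2 ∧ ∀ k : ℤ, 2 * μ (ball z.1 z.2 ∩ O k) ≤ V z} with hE'def
  have hE' : MeasurableSet E' := by
    have : E' = {z | 0 < z.2} ∩ ⋂ k : ℤ, {z | 2 * μ (ball z.1 z.2 ∩ O k) ≤ V z} := by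
      ext z; simp [hE'def]
    rw [this]
    exact (measurableSet_lt measurable_const measurable_snd).inter (MeasurableSet.iInter fun k =>
      measurableSet_le ((measurable_volume_ball_inter μ (hO k)).const_mul 2) hVm)
  have hzero : ∫⁻ z in E', ‖F z‖ₑ * ‖G z‖ₑ ∂halfMeasure μ = 0 := by
    refine le_antisymm ?_ zero_le
    -- With height a = 0 the bound is zero even if μ(X) or `N` is infinite, since 0 · ∞ = 0 in
    -- `ℝ≥0∞`.
    have := setLIntegral_level_le hD hp0 hp1 hq1 hq hqq' hF hG hN (a := 0) MeasurableSet.univ hE'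
      (fun z hz => hz.1) (fun z hz => by
        rw [inter_univ, two_mul]; exact le_self_add) (fun z hz => by
        have hset : {x | lusin μ q F x ≤ 0} = (⋃ k, O k)ᶜ := by
          ext x
          simp only [mem_ofPred_eq, nonpos_iff_eq_zero, mem_compl_iff, mem_iUnion, hOdef, not_exists,
            not_lt]
          refine ⟨fun h k => by rw [hAdef, h]; exact zero_le, fun h => ?_⟩
          by_contra h0
          have hx : A x ≠ ∞ := ne_top_of_le_ne_top (by simp) (h 0)
          obtain ⟨j, hj, -⟩ := ENNReal.exists_mem_Ioc_zpow h0 hx ENNReal.one_lt_two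
            ENNReal.ofNat_ne_top
          exact absurd hj (not_lt.2 (h j))
        rw [hset]
        refine measure_ball_le_two_mul_inter_of_compl hz.1 (MeasurableSet.iUnion hO) ?_
        have hanti : Antitone fun k => ball z.1 z.2 ∩ O k := fun j k hjk x hx => ⟨hx.1,
          lt_of_le_of_lt (ENNReal.zpow_le_of_le one_le_two hjk) hx.2⟩
        rw [inter_iUnion, (directed_of_isDirected_ge fun _ _ h => hanti h).measure_iUnion, ENNReal.mul_iSup]
        exact iSup_le hz.2)
    simpa using this
  have hcover : ∀ᵐ z ∂halfMeasure μ, z ∈ E' ∪ ⋃ k, E k := by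
    filter_upwards [ae_halfMeasure_pos μ] with z hz
    by_cases h : ∀ k : ℤ, 2 * μ (ball z.1 z.2 ∩ O k) ≤ V z
    · exact .inl ⟨hz, h⟩
    · push Not at h
      obtain ⟨k, hk⟩ := h
      obtain ⟨j, hj⟩ := exists_mem_level_diff hA htop hz hk
      exact .inr (mem_iUnion.2 ⟨j, hz, hj⟩)
  set K : ℝ≥0∞ := 2 * (2 * D) ^ (1 / p.toReal) with hK
  calc ∫⁻ z, ‖F z‖ₑ * ‖G z‖ₑ ∂halfMeasure μ
      = ∫⁻ z in E' ∪ ⋃ k, E k, ‖F z‖ₑ * ‖G z‖ₑ ∂halfMeasure μ := by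
        rw [Measure.restrict_eq_self_of_ae_mem hcover]
    _ ≤ 0 + ∑' k, ∫⁻ z in E k, ‖F z‖ₑ * ‖G z‖ₑ ∂halfMeasure μ := by
        refine (lintegral_union_le _ _ _).trans ?_
        rw [hzero]
        gcongr
        exact lintegral_iUnion_le _ _
    _ ≤ ∑' k : ℤ, K * N * (2 ^ (k + 1) * μ (O k) ^ (1 / p.toReal)) := by
        rw [zero_add]
        refine ENNReal.tsum_le_tsum fun k => ?_
        refine setLIntegral_level_le hD hp0 hp1 hq1 hq hqq' hF hG hN (hO k) (hE k)
          (fun z hz => hz.1) (fun z hz => hz.2.1.le) fun z hz => ?_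
        rw [← hAdef, ← hcompl]
        exact measure_ball_le_two_mul_inter_of_compl hz.1 (hO _) hz.2.2
    -- Moving 2^k inside the power 1/p turns the sum into one of 1/p-th powers of layer-cake terms,
    -- ready for superadditivity.
    _ = ∑' k : ℤ, K * N * 2 * (((2 : ℝ≥0∞) ^ k) ^ p.toReal * μ (O k)) ^ (1 / p.toReal) := by
        refine tsum_congr fun k => ?_
        rw [ENNReal.mul_rpow_of_nonneg _ _ (by positivity), ← ENNReal.rpow_mul,
          mul_one_div_cancel hpr.ne', ENNReal.rpow_one, ENNReal.zpow_add (by simp) (by simp),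
          zpow_one]
        ring
    _ ≤ K * N * 2 * ((1 - 2 ^ (-p.toReal))⁻¹ * ∫⁻ x, A x ^ p.toReal ∂μ) ^ (1 / p.toReal) := by
        rw [ENNReal.tsum_mul_left]
        gcongr
        refine (tsum_rpow_le_rpow_tsum _ hP).trans ?_
        gcongr
        exact tsum_zpow_rpow_mul_measure_le hpr hA
    _ = _ := by
        rw [ENNReal.mul_rpow_of_nonneg _ _ (by positivity), hnorm]
        ring

end Upper

/-! ### The lower bound: test functions on tents and the converse Hölder inequality -/

section Lower

variable {X : Type*} [MetricSpace X] [MeasurableSpace X] [BorelSpace X]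
  {μ : Measure X} [hμ : Nondegenerate μ]

/-- The vertices x whose cone contains (y,t) form B(y,t), and its measure cancels the density
V(y,t)⁻¹. -/
theorem eLpNorm_lusin_self {q : ℝ≥0∞} (hq0 : q ≠ 0) (hq : q ≠ ∞) {F : X × ℝ → ℂ}
    (hF : Measurable F) : eLpNorm (lusin μ q F) q μ = eLpNorm F q (halfMeasure μ) := by
  rw [eLpNorm_eq_lintegral_rpow_enorm_toReal hq0 hq, eLpNorm_eq_lintegral_rpow_enorm_toReal hq0 hq]
  congr 1
  simp only [enorm_eq_self, lusin_rpow hq0 hq]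
  rw [← setLIntegral_univ, setLIntegral_lintegral_cone (hF.enorm.pow_const _) univ]
  refine lintegral_congr_ae ?_
  filter_upwards [ae_halfMeasure_pos μ] with z hz
  obtain ⟨h0, h1⟩ := volume_ball_pos_lt_top (μ := μ) hz
  rw [inter_univ, mul_right_comm, ENNReal.inv_mul_cancel h0 h1, one_mul]

/-- A function carried by the tent over `B` has its `T^{p,q}` norm controlled by its `L^q` norm. -/
theorem eLpNorm_lusin_le_of_support_tent {p q : ℝ≥0∞} (hpq : p ≤ q) (hq0 : q ≠ 0) (hq : q ≠ ∞)
    {F : X × ℝ → ℂ} (hF : Measurable F) {B : Set X} (hFB : ∀ z ∉ tent B, F z = 0) :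
    eLpNorm (lusin μ q F) p μ ≤
      eLpNorm F q (halfMeasure μ) * μ B ^ (1 / p.toReal - 1 / q.toReal) := by
  have hsupp : Function.support (lusin μ q F) ⊆ B := by
    intro x hx
    by_contra hxB
    refine hx ?_
    rw [lusin]
    refine (eLpNorm_congr_ae (g := 0) ?_).trans eLpNorm_zero
    filter_upwards [ae_restrict_mem (measurableSet_cone μ x)] with z hz
    exact hFB z fun h => hxB (mem_of_mem_cone_of_mem_tent hz h)
  calc eLpNorm (lusin μ q F) p μ = eLpNorm (lusin μ q F) p (μ.restrict B) :=
        (eLpNorm_restrict_eq_of_support_subset hsupp).symm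
    _ ≤ eLpNorm (lusin μ q F) q (μ.restrict B) *
          (μ.restrict B) univ ^ (1 / p.toReal - 1 / q.toReal) :=
        eLpNorm_le_eLpNorm_mul_rpow_measure_univ hpq
          (measurable_lusin q F).aestronglyMeasurable
    _ ≤ _ := by
        rw [Measure.restrict_apply_univ, ← eLpNorm_lusin_self hq0 hq hF]
        gcongr
        exact Measure.restrict_le_self

/-- Dominated convergence in tent spaces. -/
theorem tendsto_eLpNorm_lusin_zero {p q : ℝ≥0∞} (hp0 : p ≠ 0) (hp : p ≠ ∞) (hq0 : q ≠ 0)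
    (hq : q ≠ ∞) {ι : Type*} {l : Filter ι} [l.IsCountablyGenerated] {F : ι → X × ℝ → ℂ}
    {W : X × ℝ → ℂ} (hF : ∀ i, Measurable (F i))
    (hFW : ∀ i, ∀ᵐ z ∂halfMeasure μ, ‖F i z‖ₑ ≤ ‖W z‖ₑ)
    (hlim : ∀ᵐ z ∂halfMeasure μ, Filter.Tendsto (fun i => F i z) l (nhds 0))
    (hW : eLpNorm (lusin μ q W) p μ < ∞) :
    Filter.Tendsto (fun i => eLpNorm (lusin μ q (F i)) p μ) l (nhds 0) := by
  have hpr : 0 < p.toReal := ENNReal.toReal_pos hp0 hp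
  have hqr : 0 < q.toReal := ENNReal.toReal_pos hq0 hq
  have hpow : ∀ {r : ℝ}, 0 < r → ∀ {u : ι → ℝ≥0∞}, Filter.Tendsto u l (nhds 0) →
      Filter.Tendsto (fun i => u i ^ r) l (nhds 0) := fun {r} hr {u} hu => by
    have := (ENNReal.continuous_rpow_const (y := r)).tendsto 0 |>.comp hu
    rwa [ENNReal.zero_rpow_of_pos hr] at this
  have hle : ∀ i x, lusin μ q (F i) x ≤ lusin μ q W x := fun i x =>
    eLpNorm_mono_enorm_ae ((restrict_coneMeasure_ac μ x).ae_le (hFW i))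
  have hint : ∫⁻ x, lusin μ q W x ^ p.toReal ∂μ ≠ ∞ := by
    rw [eLpNorm_eq_lintegral_rpow_enorm_toReal hp0 hp] at hW
    simp only [enorm_eq_self] at hW
    intro h
    rw [h, ENNReal.top_rpow_of_pos (by positivity)] at hW
    exact lt_irrefl _ hW
  -- Dominated convergence is applied twice: here on each cone where the Lusin functional of `W` is
  -- finite, then over X with that functional as majorant.
  have hpt : ∀ᵐ x ∂μ, Filter.Tendsto (fun i => lusin μ q (F i) x) l (nhds 0) := by
    filter_upwards [ae_lt_top ((measurable_lusin q W).pow_const _) hint] with x hx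
    have hWx : ∫⁻ z in cone x, ‖W z‖ₑ ^ q.toReal ∂coneMeasure μ ≠ ∞ := by
      rw [← lusin_rpow hq0 hq]
      refine ENNReal.rpow_ne_top_of_nonneg hqr.le fun h => ?_
      rw [h, ENNReal.top_rpow_of_pos hpr] at hx
      exact lt_irrefl _ hx
    have h := tendsto_lintegral_filter_of_dominated_convergence
      (μ := (coneMeasure μ).restrict (cone x)) (l := l)
      (F := fun i z => ‖F i z‖ₑ ^ q.toReal) (f := fun _ => 0) _
      (.of_forall fun i => (hF i).enorm.pow_const _)
      (.of_forall fun i => by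
        filter_upwards [(restrict_coneMeasure_ac μ x).ae_le (hFW i)] with z hz
        exact ENNReal.rpow_le_rpow hz hqr.le) hWx (by
        filter_upwards [(restrict_coneMeasure_ac μ x).ae_le hlim] with z hz
        exact hpow hqr (by simpa using hz.enorm))
    rw [lintegral_zero] at h
    have h' := hpow (r := 1 / q.toReal) (by positivity) h
    refine h'.congr fun i => ?_
    rw [lusin, eLpNorm_eq_lintegral_rpow_enorm_toReal hq0 hq]
  have h := tendsto_lintegral_filter_of_dominated_convergence (μ := μ) (l := l)
      (F := fun i x => lusin μ q (F i) x ^ p.toReal) (f := fun _ => 0) _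
      (.of_forall fun i => (measurable_lusin q (F i)).pow_const _)
      (.of_forall fun i => .of_forall fun x => ENNReal.rpow_le_rpow (hle i x) hpr.le) hint (by
        filter_upwards [hpt] with x hx
        exact hpow hpr hx)
  rw [lintegral_zero] at h
  refine (hpow (r := 1 / p.toReal) (by positivity) h).congr fun i => ?_
  rw [eLpNorm_eq_lintegral_rpow_enorm_toReal hp0 hp]
  simp only [enorm_eq_self]

/-- An integrable, strictly positive function of the distance to a point, decreasing in it. -/
theorem exists_antitone_lintegral_dist_lt_top (μ : Measure X) [Nondegenerate μ] (x₀ : X) :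
    ∃ e : ℝ → ℝ≥0∞, Antitone e ∧ (∀ r, 0 < e r) ∧ (∀ r, e r < ∞) ∧
      ∫⁻ x, e (dist x x₀) ∂μ < ∞ := by
  -- The second factor absorbs the mass of the ball of radius n + 1, where `a n` is used, and 2^(-n)
  -- makes the sum over n converge.
  set a : ℕ → ℝ≥0∞ := fun n => (2 ^ n)⁻¹ * (1 + μ (ball x₀ (n + 1)))⁻¹ with ha
  have hfin : ∀ n : ℕ, μ (ball x₀ (n + 1)) ≠ ∞ := fun n =>
    (Nondegenerate.lt_top x₀ _ (by positivity)).ne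
  have hanti : Antitone a := fun m n hmn => by
    simp only [ha]
    gcongr
    exact one_le_two
  refine ⟨fun r => a ⌊r⌋₊, fun r s h => hanti (Nat.floor_mono h), fun r => ?_, fun r => ?_, ?_⟩
  · refine ENNReal.mul_pos (ENNReal.inv_ne_zero.2 (by simp)) (ENNReal.inv_ne_zero.2 ?_)
    exact ENNReal.add_ne_top.2 ⟨by simp, hfin _⟩
  · refine ENNReal.mul_lt_top (ENNReal.inv_lt_top.2 (by positivity)) (ENNReal.inv_lt_top.2 ?_)
    exact lt_of_lt_of_le one_pos le_self_add
  · calc ∫⁻ x, a ⌊dist x x₀⌋₊ ∂μ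
        ≤ ∫⁻ x, ∑' n : ℕ, (ball x₀ (n + 1)).indicator (fun _ => a n) x ∂μ := by
          refine lintegral_mono fun x => ?_
          refine le_trans (le_of_eq ?_) (ENNReal.le_tsum ⌊dist x x₀⌋₊)
          rw [indicator_of_mem]
          rw [mem_ball]
          exact Nat.lt_floor_add_one _
      _ = ∑' n : ℕ, a n * μ (ball x₀ (n + 1)) := by
          rw [lintegral_tsum fun n => (measurable_const.indicator measurableSet_ball).aemeasurable]
          exact tsum_congr fun n => lintegral_indicator_const measurableSet_ball _
      _ ≤ ∑' n : ℕ, (2⁻¹ : ℝ≥0∞) ^ n := by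
          refine ENNReal.tsum_le_tsum fun n => ?_
          have h1 : (1 + μ (ball x₀ (n + 1)))⁻¹ * μ (ball x₀ (n + 1)) ≤ 1 := by
            rw [← ENNReal.div_eq_inv_mul]
            exact ENNReal.div_le_of_le_mul (by rw [one_mul]; exact le_add_self)
          calc a n * μ (ball x₀ (n + 1))
              = (2 ^ n)⁻¹ * ((1 + μ (ball x₀ (n + 1)))⁻¹ * μ (ball x₀ (n + 1))) := mul_assoc _ _ _
            _ ≤ (2 ^ n)⁻¹ * 1 := by gcongr
            _ = _ := by rw [mul_one, ENNReal.inv_pow]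
      _ < ∞ := by
          rw [ENNReal.tsum_geometric, ENNReal.one_sub_inv_two, inv_inv]
          exact ENNReal.ofNat_lt_top

/-- A strictly positive function of finite tent space norm. -/
theorem exists_pos_eLpNorm_lusin_lt_top (μ : Measure X) [Nondegenerate μ] [Nonempty X]
    {p q : ℝ≥0∞} (hp0 : p ≠ 0) (hp : p ≠ ∞) (hq0 : q ≠ 0) (hq : q ≠ ∞) :
    ∃ w : X × ℝ → ℝ, Measurable w ∧ (∀ z, 0 < z.2 → 0 < w z) ∧ (∀ z, 0 ≤ w z) ∧
      eLpNorm (lusin μ q fun z => (w z : ℂ)) p μ < ∞ := by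
  have := sigmaFinite_halfMeasure μ
  have := secondCountable_of_nondegenerate μ
  have hpr : 0 < p.toReal := ENNReal.toReal_pos hp0 hp
  have hqr : 0 < q.toReal := ENNReal.toReal_pos hq0 hq
  obtain ⟨x₀⟩ := ‹Nonempty X›
  obtain ⟨e, he, hepos, hetop, heint⟩ := exists_antitone_lintegral_dist_lt_top μ x₀
  obtain ⟨v, hvpos, hv, hvint⟩ :=
    exists_pos_lintegral_lt_of_sigmaFinite (halfMeasure μ) one_ne_zero
  -- This is w^q. The volume cancels the density of the cone measure, `v` has integral below 1, and
  -- `e` supplies the decay: the Lusin functional of w, raised to the power p, is at most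
  -- e(d(x,x₀)), which is integrable.
  set h : X × ℝ → ℝ≥0∞ := fun z =>
    v z * μ (ball z.1 z.2) * e (dist z.1 x₀ + z.2) ^ (q.toReal / p.toReal) with hh
  have hhm : Measurable h := by
    have := measurable_volume_ball μ
    have he' : Measurable fun z : X × ℝ => e (dist z.1 x₀ + z.2) :=
      he.measurable.comp (by fun_prop)
    exact (hv.coe_nnreal_ennreal.mul this).mul (he'.pow_const _)
  refine ⟨fun z => (h z ^ (1 / q.toReal)).toReal, (hhm.pow_const _).ennreal_toReal, fun z hz => ?_,
    fun z => ENNReal.toReal_nonneg, ?_⟩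
  · obtain ⟨h0, h1⟩ := volume_ball_pos_lt_top (μ := μ) hz
    have hz0 : h z ≠ 0 := mul_ne_zero (mul_ne_zero (by simpa using (hvpos z).ne') h0)
      (ENNReal.rpow_pos (hepos _) (hetop _).ne).ne'
    have hz1 : h z ≠ ∞ := ENNReal.mul_ne_top (ENNReal.mul_ne_top (by simp) h1)
      (ENNReal.rpow_ne_top_of_nonneg (by positivity) (hetop _).ne)
    exact ENNReal.toReal_pos (ENNReal.rpow_pos (pos_iff_ne_zero.2 hz0) hz1).ne'
      (ENNReal.rpow_ne_top_of_nonneg (by positivity) hz1)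
  · have hle : ∀ z, ‖(((h z ^ (1 / q.toReal)).toReal : ℝ) : ℂ)‖ₑ ^ q.toReal ≤ h z := fun z => by
      rw [← ofReal_norm, Complex.norm_real, Real.norm_of_nonneg ENNReal.toReal_nonneg]
      calc _ ≤ (h z ^ (1 / q.toReal)) ^ q.toReal :=
            ENNReal.rpow_le_rpow ENNReal.ofReal_toReal_le hqr.le
        _ = h z := by rw [← ENNReal.rpow_mul, one_div_mul_cancel hqr.ne', ENNReal.rpow_one]
    have hA : ∀ x, lusin μ q (fun z => (((h z ^ (1 / q.toReal)).toReal : ℝ) : ℂ)) x ^ q.toReal ≤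
        e (dist x x₀) ^ (q.toReal / p.toReal) := by
      intro x
      have hV : Measurable fun z : X × ℝ => (μ (ball z.1 z.2))⁻¹ := (measurable_volume_ball μ).inv
      rw [lusin_rpow hq0 hq]
      calc _ ≤ ∫⁻ z in cone x, h z ∂coneMeasure μ := lintegral_mono hle
        _ = ∫⁻ z in cone x, (μ (ball z.1 z.2))⁻¹ * h z ∂halfMeasure μ := by
            rw [coneMeasure, setLIntegral_withDensity_eq_setLIntegral_mul _ hV hhm
              (measurableSet_cone μ x)]
            rfl
        _ ≤ ∫⁻ z in cone x, e (dist x x₀) ^ (q.toReal / p.toReal) * v z ∂halfMeasure μ := by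
            refine setLIntegral_mono' (measurableSet_cone μ x) fun z hz => ?_
            have hz' : dist z.1 x < z.2 := hz
            obtain ⟨h0, h1⟩ := volume_ball_pos_lt_top (μ := μ) (dist_nonneg.trans_lt hz')
            calc (μ (ball z.1 z.2))⁻¹ * h z
                = ((μ (ball z.1 z.2))⁻¹ * μ (ball z.1 z.2)) *
                  (e (dist z.1 x₀ + z.2) ^ (q.toReal / p.toReal) * v z) := by rw [hh]; ring
              _ ≤ _ := by
                rw [ENNReal.inv_mul_cancel h0 h1, one_mul]
                gcongr
                -- On the cone over x, d(x,x₀) ≤ d(y,x₀) + t, and `e` is decreasing.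
                refine he ?_
                have := dist_triangle x z.1 x₀
                rw [dist_comm x z.1] at this
                linarith
        _ ≤ e (dist x x₀) ^ (q.toReal / p.toReal) * 1 := by
            rw [lintegral_const_mul _ hv.coe_nnreal_ennreal]
            gcongr
            exact (setLIntegral_le_lintegral _ _).trans hvint.le
        _ = _ := mul_one _
    rw [eLpNorm_eq_lintegral_rpow_enorm_toReal hp0 hp]
    refine ENNReal.rpow_lt_top_of_nonneg (by positivity) (ne_of_lt (lt_of_le_of_lt ?_ heint))
    refine lintegral_mono fun x => ?_
    rw [enorm_eq_self]
    calc _ = (lusin μ q (fun z => (((h z ^ (1 / q.toReal)).toReal : ℝ) : ℂ)) x ^ q.toReal) ^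
          (p.toReal / q.toReal) := by
          rw [← ENNReal.rpow_mul, mul_div_cancel₀ _ hqr.ne']
      _ ≤ (e (dist x x₀) ^ (q.toReal / p.toReal)) ^ (p.toReal / q.toReal) :=
          ENNReal.rpow_le_rpow (hA x) (by positivity)
      _ = e (dist x x₀) := by
          rw [← ENNReal.rpow_mul, div_mul_div_cancel₀ hpr.ne', div_self hqr.ne', ENNReal.rpow_one]

/-- The converse Hölder inequality. -/
theorem eLpNorm_le_of_forall_lintegral_mul_le {Ω : Type*} [MeasurableSpace Ω] (ν : Measure Ω)
    [SigmaFinite ν] {q q' : ℝ≥0∞} (hq1 : 1 ≤ q) (hq : q ≠ ∞) (hqq' : 1 / q + 1 / q' = 1)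
    {G : Ω → ℂ} (hG : Measurable G) {D : ℝ≥0∞}
    (h : ∀ H : Ω → ℝ≥0∞, Measurable H → ∫⁻ z, H z * ‖G z‖ₑ ∂ν ≤ D * eLpNorm H q ν) :
    eLpNorm G q' ν ≤ D := by
  rcases eq_or_ne D ∞ with rfl | hD
  · exact le_top
  rcases eq_or_lt_of_le hq1 with rfl | hq1
  · have : q' = ∞ := by
      have h0 : (1 : ℝ≥0∞) + 1 / q' = 1 + 0 := by simpa using hqq'
      rw [ENNReal.add_right_inj ENNReal.one_ne_top] at h0
      simpa using h0
    subst this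
    rw [eLpNorm_exponent_top]
    refine essSup_le_of_ae_le D ?_
    refine ae_le_of_forall_setLIntegral_le_of_sigmaFinite hG.enorm fun S hS _ => ?_
    -- For q = 1, indicators bound every set average of |G| by `D`, hence |G| itself almost
    -- everywhere.
    have hS' := h (S.indicator fun _ => 1) (measurable_const.indicator hS)
    rw [setLIntegral_const]
    rw [eLpNorm_one_eq_lintegral_enorm] at hS'
    simp only [enorm_eq_self, lintegral_indicator_const hS, one_mul] at hS'
    refine le_trans (le_of_eq ?_) hS'
    rw [← lintegral_indicator hS]
    refine lintegral_congr fun z => ?_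
    by_cases hz : z ∈ S <;> simp [hz]
  · have hq0 : q ≠ 0 := (zero_lt_one.trans hq1).ne'
    have hconj : ENNReal.HolderConjugate q q' := ENNReal.holderConjugate_iff.2 (by simpa using hqq')
    have hq'1 : 1 ≤ q' := hconj.symm.one_le
    have hq' : q' ≠ ∞ := by
      rintro rfl
      simp only [one_div, ENNReal.inv_top, add_zero, ENNReal.inv_eq_one] at hqq'
      exact hq1.ne' hqq'
    have hq'0 : q' ≠ 0 := (zero_lt_one.trans_le hq'1).ne'
    have hr : q.toReal.HolderConjugate q'.toReal := by
      refine (Real.holderConjugate_iff).2 ⟨?_, ?_⟩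
      · simpa using (ENNReal.toReal_lt_toReal (by simp) hq).2 hq1
      · have := congrArg ENNReal.toReal hqq'
        rw [ENNReal.toReal_add (by simpa using hq0) (by simpa using hq'0)] at this
        simpa using this
    have hbpos : 0 < q'.toReal := hr.symm.pos
    have hapos : 0 < q.toReal := hr.pos
    -- On `S n` the measure is finite and G bounded, so the integral `I` below is finite and a power
    -- of it may be cancelled.
    set S : ℕ → Set Ω := fun n => spanningSets ν n ∩ {z | ‖G z‖ₑ ≤ n} with hSdef
    have hS : ∀ n, MeasurableSet (S n) := fun n =>
      (measurableSet_spanningSets ν n).inter (measurableSet_le hG.enorm measurable_const)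
    have hbound : ∀ n, ∫⁻ z in S n, ‖G z‖ₑ ^ q'.toReal ∂ν ≤ D ^ q'.toReal := by
      intro n
      set I := ∫⁻ z in S n, ‖G z‖ₑ ^ q'.toReal ∂ν with hI
      have hIfin : I ≠ ∞ := by
        refine ne_of_lt (lt_of_le_of_lt (setLIntegral_mono' (hS n) (g := fun _ => (n : ℝ≥0∞) ^
          q'.toReal) fun z hz => ENNReal.rpow_le_rpow hz.2 hbpos.le) ?_)
        rw [setLIntegral_const]
        exact ENNReal.mul_lt_top (ENNReal.rpow_lt_top_of_nonneg hbpos.le (by simp))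
          ((measure_mono inter_subset_left).trans_lt (measure_spanningSets_lt_top ν n))
      have hmain : I ≤ D * I ^ (1 / q.toReal) := by
        -- The extremal function for Hölder: since (q' - 1) q = q', the hypothesis reads I ≤ D ·
        -- I^{1/q}.
        have := h ((S n).indicator fun z => ‖G z‖ₑ ^ (q'.toReal - 1))
          ((hG.enorm.pow_const _).indicator (hS n))
        rw [eLpNorm_eq_lintegral_rpow_enorm_toReal hq0 hq] at this
        convert this using 1
        · rw [hI, ← lintegral_indicator (hS n)]
          refine lintegral_congr fun z => ?_
          by_cases hz : z ∈ S n
          · simp only [indicator_of_mem hz]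
            conv_rhs => rw [← ENNReal.rpow_one ‖G z‖ₑ, ← ENNReal.rpow_mul, one_mul]
            rw [← ENNReal.rpow_add_of_nonneg _ _ (by linarith [hr.symm.lt]) zero_le_one]
            ring_nf
          · simp [indicator_of_notMem hz]
        · congr 2
          rw [hI, ← lintegral_indicator (hS n)]
          refine lintegral_congr fun z => ?_
          by_cases hz : z ∈ S n
          · simp only [indicator_of_mem hz, enorm_eq_self]
            rw [← ENNReal.rpow_mul, hr.symm.sub_one_mul_conj]
          · simp [indicator_of_notMem hz, hapos]
      rcases eq_or_ne I 0 with hI0 | hI0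
      · rw [hI0]; exact zero_le
      have hsplit : I = I ^ (1 / q'.toReal) * I ^ (1 / q.toReal) := by
        rw [← ENNReal.rpow_add_of_nonneg _ _ (by positivity) (by positivity), one_div, one_div,
          hr.symm.inv_add_inv_eq_one, ENNReal.rpow_one]
      conv_lhs at hmain => rw [hsplit]
      have hfin' : I ^ (1 / q.toReal) ≠ ∞ := ENNReal.rpow_ne_top_of_nonneg (by positivity) hIfin
      have hne' : I ^ (1 / q.toReal) ≠ 0 :=
        (ENNReal.rpow_pos (pos_iff_ne_zero.2 hI0) hIfin).ne'
      have hle := (ENNReal.mul_le_mul_iff_left hne' hfin').1 hmain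
      rw [one_div, ENNReal.rpow_inv_le_iff hbpos] at hle
      exact hle
    rw [eLpNorm_eq_lintegral_rpow_enorm_toReal hq'0 hq', one_div, ENNReal.rpow_inv_le_iff hbpos]
    have hunion : ⋃ n, S n = univ := by
      refine eq_univ_of_forall fun z => mem_iUnion.2 ?_
      obtain ⟨n, hn⟩ := ENNReal.exists_nat_gt (r := ‖G z‖ₑ) (by simp)
      obtain ⟨m, hm⟩ := mem_iUnion.1 (iUnion_spanningSets ν ▸ mem_univ z : z ∈ ⋃ i, spanningSets ν i)
      refine ⟨max m n, monotone_spanningSets ν (le_max_left _ _) hm, hn.le.trans ?_⟩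
      exact_mod_cast le_max_right m n
    rw [← setLIntegral_univ, ← hunion, setLIntegral_iUnion_of_directed]
    · exact iSup_le hbound
    · refine Monotone.directed_le fun m n hmn z hz => ⟨monotone_spanningSets ν hmn hz.1, ?_⟩
      have h2 : ‖G z‖ₑ ≤ m := hz.2
      exact h2.trans (by exact_mod_cast hmn)

/-- Converse Hölder on the tent, with competitors carried by the tent so that their T^{p,q} norm is
controlled by the L^q norm. The bound `hM` is needed only for functions dominated by a multiple of
`w`; integrability of w G makes all the integrals tested converge. -/
theorem eLpNorm_tent_le_of_forall_enorm_integral_le {p q q' : ℝ≥0∞} (hpq : p ≤ q) (hq1 : 1 ≤ q)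
    (hq : q ≠ ∞) (hqq' : 1 / q + 1 / q' = 1) {w : X × ℝ → ℝ} (hw : Measurable w)
    (hwpos : ∀ z, 0 < z.2 → 0 < w z) (hw0 : ∀ z, 0 ≤ w z) {G : X × ℝ → ℂ} (hG : Measurable G)
    (hint : Integrable (fun z => (w z : ℂ) * G z) (halfMeasure μ)) {M : ℝ≥0∞}
    (hM : ∀ F : X × ℝ → ℂ, Measurable F → (∃ n : ℕ, ∀ z, ‖F z‖ ≤ n * w z) →
      ‖∫ z, F z * conj (G z) ∂halfMeasure μ‖ₑ ≤ M * eLpNorm (lusin μ q F) p μ)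
    (B : Set X) :
    eLpNorm G q' ((halfMeasure μ).restrict (tent B)) ≤
      M * μ B ^ (1 / p.toReal - 1 / q.toReal) := by
  have hq0 : q ≠ 0 := (zero_lt_one.trans_le hq1).ne'
  have := sigmaFinite_halfMeasure μ
  have hT : MeasurableSet (tent B) := measurableSet_tent μ B
  refine eLpNorm_le_of_forall_lintegral_mul_le _ hq1 hq hqq' hG fun H hH => ?_
  -- Truncation of H by n w: it enters the admissible class and increases to H wherever w > 0, in
  -- particular on the tent.
  set K : ℕ → X × ℝ → ℝ≥0∞ := fun n z => min (H z) (n * ENNReal.ofReal (w z)) with hK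
  have hKm : ∀ n, Measurable (K n) := fun n =>
    hH.min (measurable_const.mul hw.ennreal_ofReal)
  have hKtop : ∀ n z, K n z ≠ ∞ := fun n z =>
    ne_top_of_le_ne_top (ENNReal.mul_ne_top (by simp) ENNReal.ofReal_ne_top) (min_le_right _ _)
  have hKle : ∀ n z, (K n z).toReal ≤ n * w z := fun n z => by
    refine ENNReal.toReal_le_of_le_ofReal (mul_nonneg (by positivity) (hw0 z)) ?_
    rw [ENNReal.ofReal_mul (by positivity), ENNReal.ofReal_natCast]
    exact min_le_right _ _
  have hbound : ∀ n, ∫⁻ z in tent B, K n z * ‖G z‖ₑ ∂halfMeasure μ ≤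
      M * μ B ^ (1 / p.toReal - 1 / q.toReal) *
        eLpNorm H q ((halfMeasure μ).restrict (tent B)) := by
    intro n
    -- The phase of G, zero where G vanishes by the convention for division; it makes the integrand
    -- F · conj G nonnegative.
    set σ : X × ℝ → ℂ := fun z => G z / (‖G z‖ : ℂ) with hσ
    have hσm : Measurable σ := hG.div (Complex.measurable_ofReal.comp hG.norm)
    have hσ1 : ∀ z, ‖σ z‖ ≤ 1 := fun z => by
      rw [hσ, norm_div, Complex.norm_real, norm_norm]
      exact div_self_le_one _
    have hσG : ∀ z, σ z * conj (G z) = (‖G z‖ : ℂ) := fun z => by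
      rcases eq_or_ne (G z) 0 with h | h
      · simp [hσ, h]
      · have h' : (‖G z‖ : ℂ) ≠ 0 := by simpa using h
        simp only [hσ]
        rw [div_mul_eq_mul_div, Complex.mul_conj', div_eq_iff h', sq]
    set F : X × ℝ → ℂ := (tent B).indicator fun z => ((K n z).toReal : ℂ) * σ z with hFdef
    have hFm : Measurable F :=
      ((Complex.measurable_ofReal.comp (hKm n).ennreal_toReal).mul hσm).indicator hT
    have hFK : ∀ z, ‖F z‖ ≤ (K n z).toReal := fun z => by
      refine (norm_indicator_le_norm_self _ z).trans ?_
      rw [norm_mul, Complex.norm_real, Real.norm_of_nonneg ENNReal.toReal_nonneg]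
      exact mul_le_of_le_one_right ENNReal.toReal_nonneg (hσ1 z)
    set k : X × ℝ → ℝ := (tent B).indicator fun z => (K n z).toReal * ‖G z‖ with hk
    have hk0 : ∀ z, 0 ≤ k z := fun z => indicator_nonneg (fun z _ => by positivity) z
    have hkF : ∀ z, F z * conj (G z) = (k z : ℂ) := fun z => by
      by_cases hz : z ∈ tent B
      · simp only [hFdef, hk, indicator_of_mem hz]
        rw [mul_assoc, hσG]
        push_cast
        rfl
      · simp only [hFdef, hk, indicator_of_notMem hz, zero_mul, Complex.ofReal_zero]
    have hkint : Integrable k (halfMeasure μ) := by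
      refine (hint.norm.const_mul (n : ℝ)).mono'
        (((hKm n).ennreal_toReal.mul hG.norm).indicator hT).aestronglyMeasurable
        (.of_forall fun z => ?_)
      refine (norm_indicator_le_norm_self _ z).trans ?_
      rw [norm_mul, norm_mul, norm_norm, Complex.norm_real, Real.norm_of_nonneg (hw0 z),
        Real.norm_of_nonneg ENNReal.toReal_nonneg, ← mul_assoc]
      gcongr
      exact hKle n z
    have hlhs : ‖∫ z, F z * conj (G z) ∂halfMeasure μ‖ₑ =
        ∫⁻ z in tent B, K n z * ‖G z‖ₑ ∂halfMeasure μ := by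
      simp only [hkF]
      rw [integral_complex_ofReal, ← ofReal_norm, Complex.norm_real,
        Real.norm_of_nonneg (integral_nonneg hk0),
        ofReal_integral_eq_lintegral_ofReal hkint (.of_forall hk0), ← lintegral_indicator hT]
      refine lintegral_congr fun z => ?_
      by_cases hz : z ∈ tent B
      · simp only [hk, indicator_of_mem hz]
        rw [ENNReal.ofReal_mul ENNReal.toReal_nonneg, ENNReal.ofReal_toReal (hKtop n z),
          ofReal_norm]
      · simp only [hk, indicator_of_notMem hz, ENNReal.ofReal_zero]
    rw [← hlhs]
    refine (hM F hFm ⟨n, fun z => (hFK z).trans (hKle n z)⟩).trans ?_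
    rw [mul_assoc]
    gcongr
    refine (eLpNorm_lusin_le_of_support_tent hpq hq0 hq hFm
      (fun z hz => indicator_of_notMem hz _)).trans ?_
    rw [mul_comm]
    gcongr
    rw [← eLpNorm_indicator_eq_eLpNorm_restrict hT]
    refine eLpNorm_mono_enorm_ae (.of_forall fun z => ?_)
    by_cases hz : z ∈ tent B
    · rw [indicator_of_mem hz, enorm_eq_self, ← ofReal_norm]
      exact (ENNReal.ofReal_le_ofReal (hFK z)).trans (ENNReal.ofReal_toReal_le.trans
        (min_le_left _ _))
    · rw [hFdef, indicator_of_notMem hz]; simp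
  have hmono : Monotone K := fun m n hmn z => by
    simp only [hK]
    gcongr
  calc ∫⁻ z in tent B, H z * ‖G z‖ₑ ∂halfMeasure μ
      = ∫⁻ z in tent B, ⨆ n, K n z * ‖G z‖ₑ ∂halfMeasure μ := by
        refine setLIntegral_congr_fun hT fun z hz => ?_
        have hsup : ⨆ n, K n z = H z := by
          have h1 : ⨆ n : ℕ, (n : ℝ≥0∞) * ENNReal.ofReal (w z) = ∞ := by
            rw [← ENNReal.iSup_mul, ENNReal.iSup_natCast,
              ENNReal.top_mul (by simpa using hwpos z hz.1)]
          simp only [hK]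
          rw [← inf_iSup_eq, h1, inf_top_eq]
        simp only [← hsup, ENNReal.iSup_mul]
    _ = ⨆ n, ∫⁻ z in tent B, K n z * ‖G z‖ₑ ∂halfMeasure μ :=
        lintegral_iSup (fun n => (hKm n).mul hG.enorm) fun m n hmn z => by
          simp only
          gcongr
          exact hmono hmn z
    _ ≤ _ := iSup_le hbound

end Lower

/-! ### Representation of functionals on bounded functions by Radon–Nikodym -/

section Representation

variable {Ω : Type*} [MeasurableSpace Ω]

/-- A linear functional on bounded measurable functions that is continuous under bounded almost
everywhere convergence is integration against an integrable function. -/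
theorem exists_integrable_representation (m : Measure Ω) [SigmaFinite m] (ψ : (Ω → ℂ) → ℂ)
    (hadd : ∀ f g : Ω → ℂ, Measurable f → Measurable g → (∃ C : ℝ, ∀ z, ‖f z‖ ≤ C) →
      (∃ C : ℝ, ∀ z, ‖g z‖ ≤ C) → ψ (f + g) = ψ f + ψ g)
    (hsmul : ∀ (c : ℂ) (f : Ω → ℂ), Measurable f → (∃ C : ℝ, ∀ z, ‖f z‖ ≤ C) →
      ψ (c • f) = c * ψ f)
    (hcont : ∀ {ι : Type} (l : Filter ι) [l.IsCountablyGenerated] (f : ι → Ω → ℂ),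
      (∀ i, Measurable (f i)) → (∃ C : ℝ, ∀ i z, ‖f i z‖ ≤ C) →
      (∀ᵐ z ∂m, Filter.Tendsto (fun i => f i z) l (nhds 0)) →
      Filter.Tendsto (fun i => ψ (f i)) l (nhds 0)) :
    ∃ g : Ω → ℂ, Measurable g ∧ Integrable g m ∧
      ∀ f : Ω → ℂ, Measurable f → (∃ C : ℝ, ∀ z, ‖f z‖ ≤ C) → ψ f = ∫ z, f z * g z ∂m := by
  classical
  have hind_meas : ∀ {A : Set Ω}, MeasurableSet A → Measurable (A.indicator (1 : Ω → ℂ)) :=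
    fun hA => measurable_one.indicator hA
  have hind_le : ∀ (A : Set Ω) z, ‖A.indicator (1 : Ω → ℂ) z‖ ≤ 1 := fun A z =>
    (norm_indicator_le_norm_self _ z).trans (by simp)
  have hzero : ψ 0 = 0 := by simpa using hsmul 0 0 measurable_zero ⟨0, by simp⟩
  have hempty : ψ ((∅ : Set Ω).indicator 1) = 0 := by rw [indicator_empty]; exact hzero
  have hsub : ∀ f g : Ω → ℂ, Measurable f → Measurable g → (∃ C : ℝ, ∀ z, ‖f z‖ ≤ C) →
      (∃ C : ℝ, ∀ z, ‖g z‖ ≤ C) → ψ (f - g) = ψ f - ψ g := by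
    intro f g hf hg hfb hgb
    have h1 : ψ ((-1 : ℂ) • g) = -ψ g := by rw [hsmul _ _ hg hgb]; ring
    have hb : ∃ C : ℝ, ∀ z, ‖((-1 : ℂ) • g) z‖ ≤ C := by simpa using hgb
    rw [sub_eq_add_neg (ψ f), ← h1, ← hadd _ _ hf (hg.const_smul _) hfb hb]
    congr 1
    ext z
    simp [sub_eq_add_neg]
  have hsum : ∀ (A : ℕ → Set Ω), (∀ i, MeasurableSet (A i)) →
      Pairwise (Function.onFun Disjoint A) →
      ∀ s : Finset ℕ, ψ ((⋃ i ∈ s, A i).indicator 1) = ∑ i ∈ s, ψ ((A i).indicator 1) := by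
    intro A hA hdisj s
    induction s using Finset.induction_on with
    | empty => simpa only [Finset.notMem_empty, iUnion_of_empty, iUnion_empty, Finset.sum_empty] using hempty
    | insert a s ha ih =>
      have hU : MeasurableSet (⋃ i ∈ s, A i) := s.measurableSet_biUnion fun i _ => hA i
      rw [Finset.set_biUnion_insert, indicator_union_of_disjoint, Finset.sum_insert ha, ← ih]
      · exact hadd _ _ (hind_meas (hA a)) (hind_meas hU) ⟨1, hind_le _⟩ ⟨1, hind_le _⟩
      · refine disjoint_iUnion₂_right.2 fun i hi => hdisj ?_
        rintro rfl
        exact ha hi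
  have hhasSum : ∀ (A : ℕ → Set Ω), (∀ i, MeasurableSet (A i)) →
      Pairwise (Function.onFun Disjoint A) →
      HasSum (fun i => ψ ((A i).indicator 1)) (ψ ((⋃ i, A i).indicator 1)) := by
    intro A hA hdisj
    have hU : MeasurableSet (⋃ i, A i) := MeasurableSet.iUnion hA
    -- A `HasSum` is a limit along finite subsets, whence the general countably generated filter in
    -- `hcont`. At each point the difference is eventually zero.
    have h := hcont (ι := Finset ℕ) Filter.atTop
      (fun s => (⋃ i, A i).indicator 1 - (⋃ i ∈ s, A i).indicator 1)
      (fun s => (hind_meas hU).sub (hind_meas (s.measurableSet_biUnion fun i _ => hA i)))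
      ⟨2, fun s z => (norm_sub_le _ _).trans
        ((add_le_add (hind_le _ z) (hind_le _ z)).trans (by norm_num))⟩ (by
        refine .of_forall fun z => ?_
        refine tendsto_const_nhds.congr' ?_
        by_cases hz : z ∈ ⋃ i, A i
        · obtain ⟨j, hj⟩ := mem_iUnion.1 hz
          filter_upwards [Filter.eventually_ge_atTop {j}] with s hs
          have : z ∈ ⋃ i ∈ s, A i := mem_iUnion₂.2 ⟨j, hs (Finset.mem_singleton_self j), hj⟩
          simp only [Pi.sub_apply, indicator_of_mem hz, indicator_of_mem this, sub_self]
        · refine .of_forall fun s => ?_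
          have : z ∉ ⋃ i ∈ s, A i := fun h => by
            obtain ⟨j, -, hj⟩ := mem_iUnion₂.1 h
            exact hz (mem_iUnion.2 ⟨j, hj⟩)
          simp only [Pi.sub_apply, indicator_of_notMem hz, indicator_of_notMem this, sub_self])
    have h' := (tendsto_const_nhds (x := ψ ((⋃ i, A i).indicator 1))).sub h
    rw [sub_zero] at h'
    refine h'.congr fun s => ?_
    rw [hsub _ _ (hind_meas hU) (hind_meas (s.measurableSet_biUnion fun i _ => hA i))
      ⟨1, hind_le _⟩ ⟨1, hind_le _⟩, hsum A hA hdisj, sub_sub_cancel]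
  let c : ComplexMeasure Ω :=
    { measureOf' := fun A => if MeasurableSet A then ψ (A.indicator 1) else 0
      empty' := (if_pos .empty).trans hempty
      not_measurable' := fun A hA => if_neg hA
      m_iUnion' := fun A hA hdisj => by
        simp only [if_pos (MeasurableSet.iUnion hA), if_pos (hA _)]
        exact hhasSum A hA hdisj }
  have hc : ∀ A, MeasurableSet A → c A = ψ (A.indicator 1) := fun A hA => if_pos hA
  have hac0 : ∀ A, MeasurableSet A → m A = 0 → c A = 0 := by
    intro A hA hmA
    rw [hc A hA]
    -- The constant sequence of indicators of a null set tends to zero almost everywhere, so its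
    -- constant image under ψ is zero.
    have h := hcont (ι := ℕ) Filter.atTop (fun _ => A.indicator 1) (fun _ => hind_meas hA)
      ⟨1, fun _ => hind_le A⟩ (by
        filter_upwards [measure_eq_zero_iff_ae_notMem.1 hmA] with z hz
        rw [indicator_of_notMem hz]
        exact tendsto_const_nhds)
    exact tendsto_nhds_unique tendsto_const_nhds h
  have hre_apply : ∀ A, ComplexMeasure.re c A = (c A).re := fun _ => rfl
  have him_apply : ∀ A, ComplexMeasure.im c A = (c A).im := fun _ => rfl
  have hre : (ComplexMeasure.re c) ≪ᵥ m.toENNRealVectorMeasure :=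
    VectorMeasure.AbsolutelyContinuous.mk fun A hA hmA => by
      rw [Measure.toENNRealVectorMeasure_apply_measurable hA] at hmA
      rw [hre_apply, hac0 A hA hmA, Complex.zero_re]
  have him : (ComplexMeasure.im c) ≪ᵥ m.toENNRealVectorMeasure :=
    VectorMeasure.AbsolutelyContinuous.mk fun A hA hmA => by
      rw [Measure.toENNRealVectorMeasure_apply_measurable hA] at hmA
      rw [him_apply, hac0 A hA hmA, Complex.zero_im]
  set a := (ComplexMeasure.re c).rnDeriv m with ha
  set b := (ComplexMeasure.im c).rnDeriv m with hb
  have haint : Integrable a m := SignedMeasure.integrable_rnDeriv _ _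
  have hbint : Integrable b m := SignedMeasure.integrable_rnDeriv _ _
  have ham : Measurable a := SignedMeasure.measurable_rnDeriv _ _
  have hbm : Measurable b := SignedMeasure.measurable_rnDeriv _ _
  set g : Ω → ℂ := fun z => (a z : ℂ) + (b z : ℂ) * Complex.I with hg
  have hgm : Measurable g := (Complex.measurable_ofReal.comp ham).add
    ((Complex.measurable_ofReal.comp hbm).mul_const _)
  have hgint : Integrable g m := haint.ofReal.add (hbint.ofReal.mul_const _)
  have hset : ∀ A, MeasurableSet A → ψ (A.indicator 1) = ∫ z in A, g z ∂m := by
    intro A hA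
    have h1 : (c A).re = ∫ z in A, a z ∂m := by
      have h := (SignedMeasure.absolutelyContinuous_iff_withDensityᵥ_rnDeriv_eq _ m).1 hre
      rw [← withDensityᵥ_apply haint hA, ha, h, hre_apply]
    have h2 : (c A).im = ∫ z in A, b z ∂m := by
      have h := (SignedMeasure.absolutelyContinuous_iff_withDensityᵥ_rnDeriv_eq _ m).1 him
      rw [← withDensityᵥ_apply hbint hA, hb, h, him_apply]
    rw [← hc A hA, ← Complex.re_add_im (c A), h1, h2]
    simp only [hg]
    rw [integral_add haint.ofReal.restrict (hbint.ofReal.mul_const _).restrict,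
      integral_mul_const, integral_complex_ofReal, integral_complex_ofReal]
  refine ⟨g, hgm, hgint, ?_⟩
  have hmulint : ∀ f : Ω → ℂ, Measurable f → (∃ C : ℝ, ∀ z, ‖f z‖ ≤ C) →
      Integrable (fun z => f z * g z) m := fun f hf ⟨C, hC⟩ =>
    hgint.bdd_mul hf.aestronglyMeasurable (.of_forall hC)
  have hsbdd : ∀ f : SimpleFunc Ω ℂ, ∃ C : ℝ, ∀ z, ‖f z‖ ≤ C := fun f =>
    f.exists_forall_norm_le
  have hsimple : ∀ f : SimpleFunc Ω ℂ, ψ f = ∫ z, f z * g z ∂m := by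
    intro f
    induction f using SimpleFunc.induction with
    | const t hs =>
      rename_i s
      have h1 : (⇑(SimpleFunc.piecewise s hs (SimpleFunc.const Ω t) (SimpleFunc.const Ω 0)) :
          Ω → ℂ) = t • s.indicator 1 := by
        ext z
        by_cases hz : z ∈ s <;> simp [hz]
      rw [h1, hsmul t _ (hind_meas hs) ⟨1, hind_le _⟩, hset s hs, ← integral_const_mul,
        ← integral_indicator hs]
      congr 1
      ext z
      by_cases hz : z ∈ s <;> simp [hz]
    | add hdisj hf hg' =>
      rename_i f₁ f₂
      rw [SimpleFunc.coe_add, hadd _ _ f₁.measurable f₂.measurable (hsbdd _) (hsbdd _), hf, hg',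
        ← integral_add (hmulint _ f₁.measurable (hsbdd _)) (hmulint _ f₂.measurable (hsbdd _))]
      congr 1
      ext z
      simp [add_mul]
  intro f hf hfb
  obtain ⟨C, hC⟩ := hfb
  have hsm : StronglyMeasurable f := hf.stronglyMeasurable
  have hC0 : ∀ z : Ω, 0 ≤ C := fun z => (norm_nonneg _).trans (hC z)
  have hbd : ∀ n z, ‖hsm.approxBounded C n z‖ ≤ C := fun n z =>
    hsm.norm_approxBounded_le (hC0 z) n z
  -- Simple functions converging pointwise within the fixed bound `C`: `hcont` passes to the limit
  -- in ψ, dominated convergence in the integral.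
  have hlim : ∀ z, Filter.Tendsto (fun n => hsm.approxBounded C n z) Filter.atTop (nhds (f z)) :=
    fun z => hsm.tendsto_approxBounded_of_norm_le (hC z)
  have h1 := hcont Filter.atTop (fun n => f - hsm.approxBounded C n)
    (fun n => hf.sub (SimpleFunc.measurable _))
    ⟨C + C, fun n z => (norm_sub_le _ _).trans (add_le_add (hC z) (hbd n z))⟩
    (.of_forall fun z => by simpa using (tendsto_const_nhds (x := f z)).sub (hlim z))
  have h2 : Filter.Tendsto (fun n => ∫ z, hsm.approxBounded C n z * g z ∂m) Filter.atTop
      (nhds (∫ z, f z * g z ∂m)) := by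
    refine tendsto_integral_of_dominated_convergence (fun z => C * ‖g z‖)
      (fun n => ((SimpleFunc.measurable _).mul hgm).aestronglyMeasurable)
      (hgint.norm.const_mul C) (fun n => .of_forall fun z => ?_)
      (.of_forall fun z => (hlim z).mul_const _)
    rw [norm_mul]
    gcongr
    exact hbd n z
  have h3 : Filter.Tendsto (fun n => ψ (hsm.approxBounded C n)) Filter.atTop (nhds (ψ f)) := by
    have := (tendsto_const_nhds (x := ψ f)).sub h1
    rw [sub_zero] at this
    refine this.congr fun n => ?_
    rw [hsub _ _ hf (SimpleFunc.measurable _) ⟨C, hC⟩ (hsbdd _), sub_sub_cancel]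
  refine tendsto_nhds_unique h3 (h2.congr fun n => (hsimple _).symm)

end Representation

/-! ### Weights, identification of the dual, and injectivity -/

section Duality

variable {X : Type*} [MetricSpace X] [MeasurableSpace X] [BorelSpace X]
  {μ : Measure X} [hμ : Nondegenerate μ]

/-- The exponents combine as -(1/p - 1) - 1/q' = -(1/p - 1/q), which also covers q' = ∞. -/
theorem rpow_mul_eLpNorm_smul_tent {p q q' : ℝ≥0∞} (hq1 : 1 ≤ q)
    (hqq' : 1 / q + 1 / q' = 1) (G : X × ℝ → ℂ) (c : X) {r : ℝ} (hr : 0 < r) :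
    μ (ball c r) ^ (-delta 1 p) *
      eLpNorm G q' ((μ (ball c r))⁻¹ • (halfMeasure μ).restrict (tent (ball c r))) =
    μ (ball c r) ^ (-(1 / p.toReal - 1 / q.toReal)) *
      eLpNorm G q' ((halfMeasure μ).restrict (tent (ball c r))) := by
  have h0 : μ (ball c r) ≠ 0 := (hμ.pos c r hr).ne'
  have h1 : μ (ball c r) ≠ ∞ := (hμ.lt_top c r hr).ne
  have hq0 : q ≠ 0 := (zero_lt_one.trans_le hq1).ne'
  have hq'0 : q' ≠ 0 := by rintro rfl; simp at hqq'
  have hexp : (1 / q').toReal = 1 - 1 / q.toReal := by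
    have := congrArg ENNReal.toReal hqq'
    rw [ENNReal.toReal_add (by simpa using hq0) (by simpa using hq'0)] at this
    simp only [one_div, ENNReal.toReal_inv, ENNReal.toReal_one] at this ⊢
    linarith
  rw [eLpNorm_smul_measure_of_ne_zero (ENNReal.inv_ne_zero.2 h1), smul_eq_mul, ← mul_assoc,
    ENNReal.inv_rpow, ← ENNReal.rpow_neg, ← ENNReal.rpow_add _ _ h0 h1, hexp]
  congr 2
  simp [delta]

/-- The essential supremum loses nothing: every ball has positive measure, hence contains a point
where the almost everywhere bound holds, and the Carleson functional at that point sees the ball. -/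
theorem carlesonNorm_le_iff {p q q' : ℝ≥0∞} (hq1 : 1 ≤ q)
    (hqq' : 1 / q + 1 / q' = 1) (s : ℝ) (g : L0 μ) (N : ℝ≥0∞) :
    carlesonNorm μ q' (-s) (delta 1 p) g ≤ N ↔ ∀ (c : X) (r : ℝ), 0 < r →
      eLpNorm (volPow μ s g) q' ((halfMeasure μ).restrict (tent (ball c r))) ≤
        N * μ (ball c r) ^ (1 / p.toReal - 1 / q.toReal) := by
  have hterm : ∀ (c : X) (r : ℝ), 0 < r → (μ (ball c r) ^ (-delta 1 p) *
      eLpNorm (volPow μ s g) q' ((μ (ball c r))⁻¹ • (halfMeasure μ).restrict (tent (ball c r))) ≤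
        N ↔ eLpNorm (volPow μ s g) q' ((halfMeasure μ).restrict (tent (ball c r))) ≤
        N * μ (ball c r) ^ (1 / p.toReal - 1 / q.toReal)) := by
    intro c r hr
    have h0 : μ (ball c r) ≠ 0 := (hμ.pos c r hr).ne'
    have h1 : μ (ball c r) ≠ ∞ := (hμ.lt_top c r hr).ne
    rw [rpow_mul_eLpNorm_smul_tent hq1 hqq' _ c hr, ENNReal.rpow_neg, ← ENNReal.div_eq_inv_mul,
      ENNReal.div_le_iff (ENNReal.rpow_pos (pos_iff_ne_zero.2 h0) h1).ne'
        (ENNReal.rpow_ne_top_of_ne_zero h0 h1)]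
  rw [carlesonNorm, neg_neg, eLpNorm_exponent_top]
  constructor
  · intro h c r hr
    rw [← hterm c r hr]
    have hae : ∀ᵐ x ∂μ, carleson μ q' (delta 1 p) (volPow μ s g) x ≤ N := by
      filter_upwards [ae_le_eLpNormEssSup (f := carleson μ q' (delta 1 p) (volPow μ s g))
        (μ := μ)] with x hx
      exact hx.trans h
    obtain ⟨x, hx, hxN⟩ : ∃ x ∈ ball c r, carleson μ q' (delta 1 p) (volPow μ s g) x ≤ N := by
      by_contra! hcon
      refine (hμ.pos c r hr).ne' (measure_mono_null (fun x hx => ?_) hae)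
      exact not_le.2 (hcon x hx)
    refine le_trans ?_ hxN
    exact le_iSup_of_le c (le_iSup_of_le r (le_iSup_of_le hr (le_iSup_of_le hx le_rfl)))
  · intro h
    refine essSup_le_of_ae_le _ (.of_forall fun x => ?_)
    exact iSup_le fun c => iSup_le fun r => iSup_le fun hr => iSup_le fun _ =>
      (hterm c r hr).2 (h c r hr)

theorem volPow_neg_mul_conj_volPow (s : ℝ) (f g : X × ℝ → ℂ) {z : X × ℝ} (hz : 0 < z.2) :
    volPow μ (-s) f z * conj (volPow μ s g z) = f z * conj (g z) := by
  obtain ⟨h0, h1⟩ := volume_ball_pos_lt_top (μ := μ) hz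
  have hpos : 0 < μ.real (ball z.1 z.2) := ENNReal.toReal_pos h0 h1
  have h : ((μ.real (ball z.1 z.2) ^ (-s) : ℝ) : ℂ) * ((μ.real (ball z.1 z.2) ^ s : ℝ) : ℂ) = 1 := by
    rw [← Complex.ofReal_mul, ← Real.rpow_add hpos, neg_add_cancel, Real.rpow_zero,
      Complex.ofReal_one]
  simp only [volPow, map_mul, Complex.conj_ofReal]
  linear_combination (f z * conj (g z)) * h

theorem volPow_neg_volPow (s : ℝ) (f : X × ℝ → ℂ) {z : X × ℝ} (hz : 0 < z.2) :
    volPow μ (-s) (volPow μ s f) z = f z := by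
  obtain ⟨h0, h1⟩ := volume_ball_pos_lt_top (μ := μ) hz
  have hpos : 0 < μ.real (ball z.1 z.2) := ENNReal.toReal_pos h0 h1
  have h : ((μ.real (ball z.1 z.2) ^ (-s) : ℝ) : ℂ) * ((μ.real (ball z.1 z.2) ^ s : ℝ) : ℂ) = 1 := by
    rw [← Complex.ofReal_mul, ← Real.rpow_add hpos, neg_add_cancel, Real.rpow_zero,
      Complex.ofReal_one]
  simp only [volPow]
  linear_combination (f z) * h

theorem lintegral_enorm_mul_le_tentNorm (hdoub : Doubling μ) {p q q' : ℝ≥0∞} (hp0 : 0 < p)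
    (hp1 : p < 1) (hq1 : 1 ≤ q) (hq : q < ∞) (hqq' : 1 / q + 1 / q' = 1) (s : ℝ) :
    ∃ C : ℝ≥0, ∀ f g : L0 μ, tentNorm μ p q s f < ∞ →
      ∫⁻ z, ‖f z * conj (g z)‖ₑ ∂halfMeasure μ ≤
        C * carlesonNorm μ q' (-s) (delta 1 p) g * tentNorm μ p q s f := by
  obtain ⟨D, hD⟩ := hdoub.exists_five
  have hpr : 0 < p.toReal := ENNReal.toReal_pos hp0.ne' (hp1.trans ENNReal.one_lt_top).ne
  set K : ℝ≥0∞ := 4 * (2 * D) ^ (1 / p.toReal) * ((1 - 2 ^ (-p.toReal))⁻¹) ^ (1 / p.toReal) with hK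
  have hKtop : K ≠ ∞ := by
    refine ENNReal.mul_ne_top (ENNReal.mul_ne_top (by simp)
      (ENNReal.rpow_ne_top_of_nonneg (by positivity) (ENNReal.mul_ne_top (by simp) (by simp))))
      (ENNReal.rpow_ne_top_of_nonneg (by positivity) (ENNReal.inv_ne_top.2 ?_))
    -- The layer-cake constant is finite because 2^(-p) < 1.
    exact (tsub_pos_of_lt (ENNReal.rpow_lt_one_of_one_lt_of_neg ENNReal.one_lt_two
      (by linarith))).ne'
  refine ⟨K.toNNReal, fun f g hf => ?_⟩
  rw [ENNReal.coe_toNNReal hKtop]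
  refine le_trans (le_of_eq ?_) (lintegral_enorm_mul_le hD hp0 hp1 hq1 hq hqq'
    (measurable_volPow (-s) f.measurable) (measurable_volPow s g.measurable)
    ((carlesonNorm_le_iff hq1 hqq' s g _).1 le_rfl) hf)
  refine lintegral_congr_ae ?_
  filter_upwards [ae_halfMeasure_pos μ] with z hz
  rw [← volPow_neg_mul_conj_volPow (μ := μ) s f g hz, enorm_mul, RCLike.enorm_conj]

theorem integral_volPow_eq_pairing (s : ℝ) (f g : L0 μ) :
    ∫ z, volPow μ (-s) f z * conj (volPow μ s g z) ∂halfMeasure μ = pairing μ f g := by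
  refine integral_congr_ae ?_
  filter_upwards [ae_halfMeasure_pos μ] with z hz
  exact volPow_neg_mul_conj_volPow s f g hz

/-- The class of `V^s F` in `L⁰(X⁺)`. -/
noncomputable def weightedMk (μ : Measure X) [Nondegenerate μ] (s : ℝ) (F : X × ℝ → ℂ)
    (hF : Measurable F) : L0 μ :=
  AEEqFun.mk (volPow μ s F) (measurable_volPow s hF).aestronglyMeasurable

theorem volPow_neg_weightedMk (s : ℝ) {F : X × ℝ → ℂ} (hF : Measurable F) :
    volPow μ (-s) (weightedMk μ s F hF) =ᵐ[halfMeasure μ] F := by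
  filter_upwards [ae_halfMeasure_pos μ, AEEqFun.coeFn_mk (volPow μ s F)
    (measurable_volPow s hF).aestronglyMeasurable] with z hz hz'
  rw [← volPow_neg_volPow (μ := μ) s F hz]
  simp only [volPow, weightedMk] at hz' ⊢
  rw [hz']

theorem tentNorm_weightedMk (p q : ℝ≥0∞) (s : ℝ) {F : X × ℝ → ℂ} (hF : Measurable F) :
    tentNorm μ p q s (weightedMk μ s F hF) = eLpNorm (lusin μ q F) p μ := by
  rw [tentNorm, lusin_congr (volPow_neg_weightedMk s hF)]

theorem weightedMk_eq (s : ℝ) {F : X × ℝ → ℂ} (hF : Measurable F) (f : L0 μ)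
    (h : volPow μ (-s) f =ᵐ[halfMeasure μ] F) : weightedMk μ s F hF = f := by
  refine AEEqFun.ext ?_
  filter_upwards [ae_halfMeasure_pos μ, AEEqFun.coeFn_mk (volPow μ s F)
    (measurable_volPow s hF).aestronglyMeasurable, h] with z hz hz' hzF
  rw [weightedMk, hz', volPow, ← hzF, ← volPow_neg_volPow (μ := μ) (-s) f hz, neg_neg]
  rfl

theorem weightedMk_add (s : ℝ) {F H : X × ℝ → ℂ} (hF : Measurable F) (hH : Measurable H)
    (hFH : Measurable (F + H)) :
    weightedMk μ s (F + H) hFH = weightedMk μ s F hF + weightedMk μ s H hH :=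
  weightedMk_eq s hFH _ ((volPow_add (-s) _ _).trans
    ((volPow_neg_weightedMk s hF).add (volPow_neg_weightedMk s hH)))

theorem weightedMk_smul (s : ℝ) (c : ℂ) {F : X × ℝ → ℂ} (hF : Measurable F)
    (hcF : Measurable (c • F)) :
    weightedMk μ s (c • F) hcF = c • weightedMk μ s F hF :=
  weightedMk_eq s hcF _ ((volPow_smul (-s) c _).trans ((volPow_neg_weightedMk s hF).const_smul c))

theorem eLpNorm_lusin_le_of_norm_le {p q : ℝ≥0∞} {F : X × ℝ → ℂ} {w : X × ℝ → ℝ} {C : ℝ≥0}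
    (h : ∀ᵐ z ∂halfMeasure μ, ‖F z‖ ≤ C * w z) :
    eLpNorm (lusin μ q F) p μ ≤ C * eLpNorm (lusin μ q fun z => (w z : ℂ)) p μ := by
  refine eLpNorm_le_nnreal_smul_eLpNorm_of_ae_le_mul' (.of_forall fun x => ?_) p
  simp only [enorm_eq_self]
  refine eLpNorm_le_nnreal_smul_eLpNorm_of_ae_le_mul' ?_ q
  filter_upwards [(restrict_coneMeasure_ac μ x).ae_le h] with z hz
  rw [← ofReal_norm, ← ofReal_norm, Complex.norm_real, Real.norm_eq_abs,
    ← ENNReal.ofReal_coe_nnreal, ← ENNReal.ofReal_mul C.coe_nonneg]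
  refine ENNReal.ofReal_le_ofReal (hz.trans ?_)
  gcongr
  exact le_abs_self _

/-- Restricting the tests to functions dominated by multiples of `w` lets this apply to a `g` not
yet known to lie in the Carleson space, as in `exists_carleson_representation`. -/
theorem carlesonNorm_le_of_forall_pairing {p q q' : ℝ≥0∞} (hp1 : p < 1) (hq1 : 1 ≤ q)
    (hq : q < ∞) (hqq' : 1 / q + 1 / q' = 1) (s : ℝ) {w : X × ℝ → ℝ} (hw : Measurable w)
    (hwpos : ∀ z, 0 < z.2 → 0 < w z) (hw0 : ∀ z, 0 ≤ w z)
    (hwT : eLpNorm (lusin μ q fun z => (w z : ℂ)) p μ < ∞) {g : L0 μ}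
    (hint : Integrable (fun z => (w z : ℂ) * volPow μ s g z) (halfMeasure μ)) {M : ℝ≥0∞}
    (hM : ∀ f ∈ tentSpace μ p q s, (∃ n : ℕ, ∀ᵐ z ∂halfMeasure μ, ‖volPow μ (-s) f z‖ ≤ n * w z) →
      ‖pairing μ f g‖ₑ ≤ M * tentNorm μ p q s f) :
    carlesonNorm μ q' (-s) (delta 1 p) g ≤ M := by
  rw [carlesonNorm_le_iff hq1 hqq']
  intro c r _
  refine eLpNorm_tent_le_of_forall_enorm_integral_le (hp1.le.trans hq1) hq1 hq.ne hqq' hw hwpos hw0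
    (measurable_volPow s g.measurable) hint ?_ _
  rintro F hF ⟨n, hn⟩
  have hmem : weightedMk μ s F hF ∈ tentSpace μ p q s := by
    change tentNorm μ p q s _ < ∞
    rw [tentNorm_weightedMk]
    exact (eLpNorm_lusin_le_of_norm_le (C := n) (.of_forall fun z => by simpa using hn z)).trans_lt
      (ENNReal.mul_lt_top (by simp) hwT)
  have h := hM _ hmem ⟨n, by
    filter_upwards [volPow_neg_weightedMk s hF] with z hz
    rw [hz]; exact hn z⟩
  rw [tentNorm_weightedMk, ← integral_volPow_eq_pairing s] at h
  refine le_trans (le_of_eq ?_) h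
  congr 1
  refine integral_congr_ae ?_
  filter_upwards [volPow_neg_weightedMk s hF] with z hz
  rw [hz]

theorem integrable_mul_conj_of_lintegral_lt_top {f g : L0 μ}
    (h : ∫⁻ z, ‖f z * conj (g z)‖ₑ ∂halfMeasure μ < ∞) :
    Integrable (fun z => f z * conj (g z)) (halfMeasure μ) :=
  ⟨(f.measurable.mul (Complex.continuous_conj.measurable.comp g.measurable)).aestronglyMeasurable,
    h⟩

/-- Every bounded functional is represented on the functions dominated by a multiple of a positive
element of the tent space. -/
theorem exists_representation_of_dominated {p q : ℝ≥0∞} (hp0 : p ≠ 0) (hp : p ≠ ∞) (hq0 : q ≠ 0)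
    (hq : q ≠ ∞) (s : ℝ) {w : X × ℝ → ℝ} (hw : Measurable w)
    (hwpos : ∀ z, 0 < z.2 → 0 < w z) (hw0 : ∀ z, 0 ≤ w z)
    (hwT : eLpNorm (lusin μ q fun z => (w z : ℂ)) p μ < ∞) (φ : tentDual μ p q s) :
    ∃ g : L0 μ, Integrable (fun z => (w z : ℂ) * volPow μ s g z) (halfMeasure μ) ∧
      ∀ f : tentSpace μ p q s,
        (∃ n : ℕ, ∀ᵐ z ∂halfMeasure μ, ‖volPow μ (-s) (f : L0 μ) z‖ ≤ n * w z) →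
        (φ : Module.Dual ℂ (tentSpace μ p q s)) f = pairing μ f g := by
  classical
  have := sigmaFinite_halfMeasure μ
  obtain ⟨φ, C₀, hφ⟩ := φ
  have hwc : Measurable fun z => (w z : ℂ) := Complex.measurable_ofReal.comp hw
  have hmul : ∀ {h : X × ℝ → ℂ}, Measurable h → Measurable (h * fun z => (w z : ℂ)) :=
    fun hh => hh.mul hwc
  have hmem : ∀ {h : X × ℝ → ℂ} (hh : Measurable h), (∃ C : ℝ, ∀ z, ‖h z‖ ≤ C) →
      weightedMk μ s (h * fun z => (w z : ℂ)) (hmul hh) ∈ tentSpace μ p q s := by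
    rintro h hh ⟨C, hC⟩
    change tentNorm μ p q s _ < ∞
    rw [tentNorm_weightedMk]
    refine (eLpNorm_lusin_le_of_norm_le (C := C.toNNReal) (w := w)
      (.of_forall fun z => ?_)).trans_lt (ENNReal.mul_lt_top (by simp) hwT)
    rw [Pi.mul_apply, norm_mul, Complex.norm_real, Real.norm_of_nonneg (hw0 z)]
    gcongr
    · exact hw0 z
    · exact (hC z).trans (Real.le_coe_toNNReal C)
  -- The functional h ↦ φ(V^s (h w)); the value 0 off the bounded measurable functions plays no
  -- role.
  let ψ : (X × ℝ → ℂ) → ℂ := fun h =>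
    if hh : Measurable h ∧ ∃ C : ℝ, ∀ z, ‖h z‖ ≤ C then φ ⟨_, hmem hh.1 hh.2⟩ else 0
  have hψ : ∀ {h : X × ℝ → ℂ} (hh : Measurable h) (hb : ∃ C : ℝ, ∀ z, ‖h z‖ ≤ C),
      ψ h = φ ⟨_, hmem hh hb⟩ := fun hh hb => dif_pos ⟨hh, hb⟩
  obtain ⟨g₀, hg₀m, hg₀, hrep⟩ := exists_integrable_representation (halfMeasure μ) ψ
    (by
      intro f g hf hg hfb hgb
      have hfgb : ∃ C : ℝ, ∀ z, ‖(f + g) z‖ ≤ C := by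
        obtain ⟨C, hC⟩ := hfb
        obtain ⟨D, hD⟩ := hgb
        exact ⟨C + D, fun z => (norm_add_le _ _).trans (add_le_add (hC z) (hD z))⟩
      rw [hψ hf hfb, hψ hg hgb, hψ (hf.add hg) hfgb, ← map_add]
      congr 1
      refine Subtype.ext ?_
      simp only [add_mul]
      exact weightedMk_add s (hmul hf) (hmul hg) _)
    (by
      intro c f hf hfb
      have hcfb : ∃ C : ℝ, ∀ z, ‖(c • f) z‖ ≤ C := by
        obtain ⟨C, hC⟩ := hfb
        refine ⟨‖c‖ * C, fun z => ?_⟩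
        rw [Pi.smul_apply, norm_smul]
        gcongr
        exact hC z
      rw [hψ hf hfb, hψ (hf.const_smul c) hcfb]
      refine Eq.trans ?_ (map_smul φ c _)
      congr 1
      refine Subtype.ext ?_
      simp only [smul_mul_assoc]
      exact weightedMk_smul s c (hmul hf) _)
    (by
      rintro ι l _ f hf ⟨C, hC⟩ hlim
      rw [tendsto_zero_iff_enorm_tendsto_zero]
      have hdct := tendsto_eLpNorm_lusin_zero (μ := μ) (p := p) (q := q) hp0 hp hq0 hq (l := l)
        (F := fun i => f i * fun z => (w z : ℂ)) (W := fun z => ((C * w z : ℝ) : ℂ))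
        (fun i => hmul (hf i)) (fun i => .of_forall fun z => by
          have hC0 : 0 ≤ C := (norm_nonneg _).trans (hC i z)
          rw [← ofReal_norm, ← ofReal_norm, Pi.mul_apply, norm_mul, Complex.norm_real,
            Complex.norm_real, norm_mul, Real.norm_of_nonneg hC0]
          exact ENNReal.ofReal_le_ofReal (mul_le_mul_of_nonneg_right (hC i z) (norm_nonneg _)))
        (by
          filter_upwards [hlim] with z hz
          simpa using hz.mul_const (w z : ℂ))
        ((eLpNorm_lusin_le_of_norm_le (C := ‖C‖₊) (w := w) (.of_forall fun z => by
          rw [Complex.norm_real, norm_mul, Real.norm_of_nonneg (hw0 z), coe_nnnorm])).trans_lt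
          (ENNReal.mul_lt_top (by simp) hwT))
      have hdct' := ENNReal.Tendsto.const_mul (a := (C₀ : ℝ≥0∞)) hdct (.inr ENNReal.coe_ne_top)
      rw [mul_zero] at hdct'
      refine tendsto_of_tendsto_of_tendsto_of_le_of_le tendsto_const_nhds hdct'
        (fun i => zero_le) fun i => ?_
      rw [hψ (hf i) ⟨C, hC i⟩]
      refine (hφ _).trans (le_of_eq ?_)
      rw [tentNorm_weightedMk])
  -- Dividing the density by w undoes the multiplication of h by w; the conjugate matches the
  -- sesquilinear pairing.
  set G : X × ℝ → ℂ := fun z => conj (g₀ z / (w z : ℂ)) with hGdef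
  have hG : Measurable G := Complex.continuous_conj.measurable.comp (hg₀m.div hwc)
  have hgG : volPow μ s (weightedMk μ (-s) G hG) =ᵐ[halfMeasure μ] G := by
    simpa using volPow_neg_weightedMk (-s) hG
  refine ⟨weightedMk μ (-s) G hG, ?_, ?_⟩
  · refine hg₀.mono (hwc.mul (measurable_volPow s (AEEqFun.measurable _))).aestronglyMeasurable ?_
    filter_upwards [hgG, ae_halfMeasure_pos μ] with z hz hz0
    have hwz := hwpos z hz0
    rw [hz, hGdef, norm_mul, RCLike.norm_conj, norm_div, mul_div_cancel₀]
    rw [Complex.norm_real, Real.norm_of_nonneg hwz.le]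
    exact hwz.ne'
  · rintro ⟨f, hf⟩ ⟨n, hn⟩
    set F := volPow μ (-s) f with hFdef
    have hF : Measurable F := measurable_volPow (-s) f.measurable
    have hS : MeasurableSet {z | ‖F z‖ ≤ n * w z} :=
      measurableSet_le hF.norm (hw.const_mul _)
    -- The representation asks for a bound at every point, whereas domination holds only almost
    -- everywhere, hence the cut-off.
    set h : X × ℝ → ℂ := {z | ‖F z‖ ≤ n * w z}.indicator fun z => F z / (w z : ℂ) with hhdef
    have hh : Measurable h := (hF.div hwc).indicator hS
    have hb : ∀ z, ‖h z‖ ≤ n := fun z => by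
      by_cases hz : ‖F z‖ ≤ n * w z
      · rw [hhdef, indicator_of_mem (by exact hz), norm_div, Complex.norm_real,
          Real.norm_of_nonneg (hw0 z)]
        exact div_le_of_le_mul₀ (hw0 z) (by positivity) hz
      · rw [hhdef, indicator_of_notMem (by exact hz), norm_zero]
        positivity
    have hhF : ∀ᵐ z ∂halfMeasure μ, h z = F z / (w z : ℂ) := by
      filter_upwards [hn] with z hz
      rw [hhdef, indicator_of_mem (by exact hz)]
    have hφf : φ ⟨f, hf⟩ = ψ h := by
      rw [hψ hh ⟨n, hb⟩]
      congr 1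
      refine Subtype.ext (weightedMk_eq s (hmul hh) f ?_).symm
      filter_upwards [hhF, ae_halfMeasure_pos μ] with z hz hz0
      have hwz : (w z : ℂ) ≠ 0 := by exact_mod_cast (hwpos z hz0).ne'
      rw [Pi.mul_apply, hz, div_mul_cancel₀ _ hwz]
    change φ ⟨f, hf⟩ = _
    rw [hφf, hrep h hh ⟨n, hb⟩, ← integral_volPow_eq_pairing s]
    refine integral_congr_ae ?_
    filter_upwards [hhF, hgG] with z hz hzG
    rw [hz, hzG, hGdef]
    simp only [Complex.conj_conj]
    ring

/-- The density obtained on dominated functions has Carleson norm at most the bound of φ, so its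
pairing with any f converges absolutely. Cutting f to {|V^{-s} f| ≤ n w} and letting n grow, φ
converges by dominated convergence in the tent space, and the pairing by dominated convergence in
L¹. -/
theorem exists_carleson_representation [Nonempty X] (hdoub : Doubling μ) {p q q' : ℝ≥0∞}
    (hp0 : 0 < p)
    (hp1 : p < 1) (hq1 : 1 ≤ q) (hq : q < ∞) (hqq' : 1 / q + 1 / q' = 1) (s : ℝ)
    (φ : tentDual μ p q s) :
    ∃ g ∈ carlesonSpace μ q' (-s) (delta 1 p), ∀ f : tentSpace μ p q s,
      (φ : Module.Dual ℂ (tentSpace μ p q s)) f = pairing μ f g := by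
  have hp : p ≠ ∞ := (hp1.trans ENNReal.one_lt_top).ne
  have hq0 : q ≠ 0 := (zero_lt_one.trans_le hq1).ne'
  obtain ⟨w, hw, hwpos, hw0, hwT⟩ := exists_pos_eLpNorm_lusin_lt_top μ hp0.ne' hp hq0 hq.ne
  obtain ⟨g, hgint, hg⟩ :=
    exists_representation_of_dominated hp0.ne' hp hq0 hq.ne s hw hwpos hw0 hwT φ
  obtain ⟨C₀, hC₀⟩ := φ.2
  have hgC : carlesonNorm μ q' (-s) (delta 1 p) g ≤ C₀ :=
    carlesonNorm_le_of_forall_pairing hp1 hq1 hq hqq' s hw hwpos hw0 hwT hgint fun f hf hn => by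
      rw [← hg ⟨f, hf⟩ hn]
      exact hC₀ ⟨f, hf⟩
  have hgmem : carlesonNorm μ q' (-s) (delta 1 p) g < ∞ := hgC.trans_lt ENNReal.coe_lt_top
  refine ⟨g, hgmem, ?_⟩
  rintro ⟨f, hf⟩
  obtain ⟨C, hC⟩ := lintegral_enorm_mul_le_tentNorm hdoub hp0 hp1 hq1 hq hqq' s
  have hfgint : Integrable (fun z => f z * conj (g z)) (halfMeasure μ) :=
    integrable_mul_conj_of_lintegral_lt_top ((hC f g hf).trans_lt
      (ENNReal.mul_lt_top (ENNReal.mul_lt_top ENNReal.coe_lt_top hgmem) hf))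
  set F := volPow μ (-s) f with hFdef
  have hF : Measurable F := measurable_volPow (-s) f.measurable
  set S : ℕ → Set (X × ℝ) := fun n => {z | ‖F z‖ ≤ n * w z} with hSdef
  have hS : ∀ n, MeasurableSet (S n) := fun n => measurableSet_le hF.norm (hw.const_mul _)
  have hFn : ∀ n, Measurable ((S n).indicator F) := fun n => hF.indicator (hS n)
  have hFn' : ∀ n, Measurable ((S n)ᶜ.indicator F) := fun n => hF.indicator (hS n).compl
  have hmono : ∀ {T : Set (X × ℝ)} (hT : Measurable (T.indicator F)),
      weightedMk μ s (T.indicator F) hT ∈ tentSpace μ p q s := fun {T} hT => by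
    refine lt_of_le_of_lt (b := tentNorm μ p q s f) ?_ hf
    rw [tentNorm_weightedMk]
    refine eLpNorm_mono_enorm_ae (.of_forall fun x => ?_)
    simp only [enorm_eq_self]
    exact eLpNorm_indicator_le _
  have hevent : ∀ z, 0 < z.2 → ∀ᶠ n in Filter.atTop, z ∈ S n := fun z hz => by
    obtain ⟨N, hN⟩ := exists_nat_ge (‖F z‖ / w z)
    filter_upwards [Filter.eventually_ge_atTop N] with n hn
    have : (N : ℝ) ≤ n := by exact_mod_cast hn
    exact (div_le_iff₀ (hwpos z hz)).1 (hN.trans this)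
  set fn : ℕ → tentSpace μ p q s := fun n => ⟨weightedMk μ s ((S n).indicator F) (hFn n),
    hmono (hFn n)⟩ with hfn
  have hlim1 : Filter.Tendsto (fun n => (φ : Module.Dual ℂ (tentSpace μ p q s)) (fn n))
      Filter.atTop (nhds ((φ : Module.Dual ℂ (tentSpace μ p q s)) ⟨f, hf⟩)) := by
    have hdct := tendsto_eLpNorm_lusin_zero (μ := μ) hp0.ne' hp hq0 hq.ne (l := Filter.atTop)
      (F := fun n => (S n)ᶜ.indicator F) (W := F) hFn'
      (fun n => .of_forall fun z => enorm_indicator_le_enorm_self _ z) (by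
        filter_upwards [ae_halfMeasure_pos μ] with z hz
        refine tendsto_const_nhds.congr' ?_
        filter_upwards [hevent z hz] with n hn
        rw [indicator_of_notMem (by simpa using hn)]) hf
    have hdct' := ENNReal.Tendsto.const_mul (a := (C₀ : ℝ≥0∞)) hdct (.inr ENNReal.coe_ne_top)
    rw [mul_zero] at hdct'
    rw [← tendsto_sub_nhds_zero_iff, tendsto_zero_iff_enorm_tendsto_zero]
    refine tendsto_of_tendsto_of_tendsto_of_le_of_le tendsto_const_nhds hdct'
        (fun i => zero_le) fun n => ?_
    -- The error is φ of the part of f off `S n`, whose tent norm tends to zero.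
    have hsplit : (⟨f, hf⟩ : tentSpace μ p q s) = fn n + ⟨_, hmono (hFn' n)⟩ := by
      refine Subtype.ext ?_
      refine (weightedMk_eq s ((hFn n).add (hFn' n)) f ?_).symm.trans
        (weightedMk_add s (hFn n) (hFn' n) _)
      rw [indicator_self_add_compl]
    rw [hsplit, map_add, sub_add_cancel_left, enorm_neg]
    refine (hC₀ _).trans (le_of_eq ?_)
    rw [tentNorm_weightedMk]
  have hlim2 : Filter.Tendsto (fun n => pairing μ (fn n) g) Filter.atTop
      (nhds (pairing μ f g)) := by
    refine tendsto_integral_of_dominated_convergence (fun z => ‖f z * conj (g z)‖)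
      (fun n => ((AEEqFun.measurable _).mul
        (Complex.continuous_conj.measurable.comp g.measurable)).aestronglyMeasurable)
      hfgint.norm (fun n => ?_) ?_
    · filter_upwards [ae_halfMeasure_pos μ, volPow_neg_weightedMk s (hFn n)] with z hz hzn
      rw [← volPow_neg_mul_conj_volPow (μ := μ) s (fn n : L0 μ) g hz, ← volPow_neg_mul_conj_volPow (μ := μ) s f g hz,
        hzn, norm_mul, norm_mul]
      gcongr
      exact norm_indicator_le_norm_self _ z
    · filter_upwards [ae_halfMeasure_pos μ,
        ae_all_iff.2 fun n => volPow_neg_weightedMk s (hFn n)] with z hz hzn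
      refine tendsto_const_nhds.congr' ?_
      filter_upwards [hevent z hz] with n hn
      rw [← volPow_neg_mul_conj_volPow (μ := μ) s (fn n : L0 μ) g hz, ← volPow_neg_mul_conj_volPow (μ := μ) s f g hz,
        hzn, indicator_of_mem hn]
  refine tendsto_nhds_unique hlim1 (hlim2.congr fun n => (hg _ ⟨n, ?_⟩).symm)
  filter_upwards [volPow_neg_weightedMk s (hFn n)] with z hz
  rw [hz]
  by_cases h : z ∈ S n
  · rw [indicator_of_mem h]; exact h
  · rw [indicator_of_notMem h, norm_zero]
    exact mul_nonneg (by positivity) (hw0 z)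

/-- Homogeneity, by normalizing f. If f has norm zero it cannot be normalized, and boundedness of φ
gives φ(f) = 0 directly. -/
theorem enorm_le_dualNorm_mul_tentNorm {p q : ℝ≥0∞} {s : ℝ} (φ : tentDual μ p q s)
    (f : tentSpace μ p q s) :
    ‖(φ : Module.Dual ℂ (tentSpace μ p q s)) f‖ₑ ≤ dualNorm φ * tentNorm μ p q s f := by
  have hfin : tentNorm μ p q s f ≠ ∞ := f.2.ne
  rcases eq_or_ne (tentNorm μ p q s f) 0 with h0 | h0
  · obtain ⟨C, hC⟩ := φ.2
    refine (hC f).trans ?_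
    simp [h0]
  set τ := (tentNorm μ p q s f).toReal with hτ
  have hτpos : 0 < τ := ENNReal.toReal_pos h0 hfin
  have hτe : ‖(τ : ℂ)‖ₑ = tentNorm μ p q s f := by
    rw [← ofReal_norm, Complex.norm_real, Real.norm_of_nonneg hτpos.le, hτ,
      ENNReal.ofReal_toReal hfin]
  have hτc : (τ : ℂ) ≠ 0 := by exact_mod_cast hτpos.ne'
  have hle : tentNorm μ p q s (((τ : ℂ)⁻¹ • f : tentSpace μ p q s) : L0 μ) ≤ 1 := by
    refine (tentNorm_smul_le p q s _ _).trans ?_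
    rw [enorm_inv hτc, hτe, ENNReal.inv_mul_cancel h0 hfin]
  have h : ‖(φ : Module.Dual ℂ (tentSpace μ p q s)) ((τ : ℂ)⁻¹ • f)‖ₑ ≤ dualNorm φ :=
    le_iSup₂_of_le (f := fun (f : tentSpace μ p q s) (_ : tentNorm μ p q s f ≤ 1) =>
      ‖(φ : Module.Dual ℂ (tentSpace μ p q s)) f‖ₑ) _ hle le_rfl
  calc ‖(φ : Module.Dual ℂ (tentSpace μ p q s)) f‖ₑ
      = ‖(φ : Module.Dual ℂ (tentSpace μ p q s)) ((τ : ℂ) • ((τ : ℂ)⁻¹ • f))‖ₑ := by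
        rw [smul_inv_smul₀ hτc]
    _ = tentNorm μ p q s f * ‖(φ : Module.Dual ℂ (tentSpace μ p q s)) ((τ : ℂ)⁻¹ • f)‖ₑ := by
        rw [map_smul, enorm_smul, hτe]
    _ ≤ dualNorm φ * tentNorm μ p q s f := by
        rw [mul_comm]
        gcongr

/-- The tents over the balls of radius n + 1 around a fixed point exhaust the half-space, and V^s
does not vanish there. -/
theorem eq_zero_of_carlesonNorm_eq_zero [Nonempty X] {p q q' : ℝ≥0∞} (hq1 : 1 ≤ q)
    (hqq' : 1 / q + 1 / q' = 1) (s : ℝ) {g : L0 μ}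
    (h : carlesonNorm μ q' (-s) (delta 1 p) g = 0) : g = 0 := by
  obtain ⟨x₀⟩ := ‹Nonempty X›
  have hq'0 : q' ≠ 0 := by rintro rfl; simp at hqq'
  have hG : Measurable (volPow μ s g) := measurable_volPow s g.measurable
  have hloc : ∀ n : ℕ, ∀ᵐ z ∂halfMeasure μ, z ∈ tent (ball x₀ (n + 1)) → volPow μ s g z = 0 := by
    intro n
    have h1 := (carlesonNorm_le_iff hq1 hqq' s g 0).1 h.le x₀ (n + 1) (by positivity)
    rw [zero_mul, nonpos_iff_eq_zero, eLpNorm_eq_zero_iff hG.aestronglyMeasurable hq'0] at h1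
    exact (ae_restrict_iff' (measurableSet_tent μ _)).1 h1
  refine AEEqFun.ext ?_
  filter_upwards [ae_all_iff.2 hloc, ae_halfMeasure_pos μ, AEEqFun.coeFn_zero (α := X × ℝ)
    (β := ℂ) (μ := halfMeasure μ)] with z hz hz0 hzero
  obtain ⟨n, hn⟩ := exists_nat_ge (dist z.1 x₀ + z.2)
  have hmem : z ∈ tent (ball x₀ (n + 1)) := ⟨hz0, fun y hy => by
    rw [mem_ball] at hy ⊢
    have := dist_triangle y z.1 x₀
    linarith⟩
  have hv := enorm_volPow (μ := μ) s g hz0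
  obtain ⟨h0, h1⟩ := volume_ball_pos_lt_top (μ := μ) hz0
  rw [hz n hmem, enorm_zero] at hv
  rw [hzero, Pi.zero_apply]
  have := (mul_eq_zero.1 hv.symm).resolve_left (ENNReal.rpow_pos (pos_iff_ne_zero.2 h0) h1).ne'
  simpa using this

end Duality

end TentSpace

/-! ### The duality theorem -/

open TentSpace
theorem mainTheorem5 {X : Type*} [MetricSpace X] [Nonempty X] [MeasurableSpace X] [BorelSpace X]
    (μ : Measure X) [Nondegenerate μ] (hμ : Doubling μ)
    (p q q' : ℝ≥0∞) (hp0 : 0 < p) (hp1 : p < 1) (hq1 : 1 ≤ q) (hq : q < ∞)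
    (hqq' : 1 / q + 1 / q' = 1) (s : ℝ) :
    (∀ f ∈ tentSpace μ p q s, ∀ g ∈ carlesonSpace μ q' (-s) (delta 1 p),
      Integrable (fun z => f z * conj (g z)) (halfMeasure μ)) ∧
    ∃ Φ : carlesonSpace μ q' (-s) (delta 1 p) ≃ₛₗ[starRingEnd ℂ] tentDual μ p q s,
      (∀ (g : carlesonSpace μ q' (-s) (delta 1 p)) (f : tentSpace μ p q s),
        (Φ g : Module.Dual ℂ (tentSpace μ p q s)) f = pairing μ f g) ∧
      ∃ C : ℝ≥0, ∀ g : carlesonSpace μ q' (-s) (delta 1 p),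
        dualNorm (Φ g) ≤ C * carlesonNorm μ q' (-s) (delta 1 p) g ∧
        carlesonNorm μ q' (-s) (delta 1 p) g ≤ C * dualNorm (Φ g) := by
  have hp : p ≠ ∞ := (hp1.trans ENNReal.one_lt_top).ne
  have hq0 : q ≠ 0 := (zero_lt_one.trans_le hq1).ne'
  obtain ⟨C, hC⟩ := lintegral_enorm_mul_le_tentNorm hμ hp0 hp1 hq1 hq hqq' s
  have hint : ∀ f ∈ tentSpace μ p q s, ∀ g ∈ carlesonSpace μ q' (-s) (delta 1 p),
      Integrable (fun z => f z * conj (g z)) (halfMeasure μ) := fun f hf g hg =>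
    integrable_mul_conj_of_lintegral_lt_top ((hC f g hf).trans_lt
      (ENNReal.mul_lt_top (ENNReal.mul_lt_top ENNReal.coe_lt_top hg) hf))
  refine ⟨hint, ?_⟩
  have hbound : ∀ (f : tentSpace μ p q s) (g : carlesonSpace μ q' (-s) (delta 1 p)),
      ‖pairing μ f g‖ₑ ≤ C * carlesonNorm μ q' (-s) (delta 1 p) g * tentNorm μ p q s f :=
    fun f g => (enorm_integral_le_lintegral_enorm _).trans (hC f g f.2)
  let pairL : carlesonSpace μ q' (-s) (delta 1 p) → Module.Dual ℂ (tentSpace μ p q s) := fun g =>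
    { toFun := fun f => pairing μ f g
      map_add' := fun f₁ f₂ => by
        rw [pairing, pairing, pairing, ← integral_add (hint _ f₁.2 _ g.2) (hint _ f₂.2 _ g.2)]
        refine integral_congr_ae ?_
        filter_upwards [AEEqFun.coeFn_add (f₁ : L0 μ) (f₂ : L0 μ)] with z hz
        simp only [Submodule.coe_add, hz, Pi.add_apply, add_mul]
      map_smul' := fun c f => by
        rw [pairing, pairing, RingHom.id_apply, smul_eq_mul, ← integral_const_mul]
        refine integral_congr_ae ?_
        filter_upwards [AEEqFun.coeFn_smul c (f : L0 μ)] with z hz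
        simp only [Submodule.coe_smul, hz, Pi.smul_apply, smul_eq_mul, mul_assoc] }
  have hmem : ∀ g, pairL g ∈ tentDual μ p q s := fun g =>
    ⟨C * (carlesonNorm μ q' (-s) (delta 1 p) g).toNNReal, fun f => by
      rw [ENNReal.coe_mul, ENNReal.coe_toNNReal g.2.ne]
      exact hbound f g⟩
  let Φ₀ : carlesonSpace μ q' (-s) (delta 1 p) →ₛₗ[starRingEnd ℂ] tentDual μ p q s :=
    { toFun := fun g => ⟨pairL g, hmem g⟩
      map_add' := fun g₁ g₂ => by
        refine Subtype.ext (LinearMap.ext fun f => ?_)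
        change pairing μ f (g₁ + g₂ : carlesonSpace μ q' (-s) (delta 1 p)) =
          pairing μ f g₁ + pairing μ f g₂
        rw [pairing, pairing, pairing, ← integral_add (hint _ f.2 _ g₁.2) (hint _ f.2 _ g₂.2)]
        refine integral_congr_ae ?_
        filter_upwards [AEEqFun.coeFn_add (g₁ : L0 μ) (g₂ : L0 μ)] with z hz
        simp only [Submodule.coe_add, hz, Pi.add_apply, map_add, mul_add]
      map_smul' := fun c g => by
        refine Subtype.ext (LinearMap.ext fun f => ?_)
        change pairing μ f (c • g : carlesonSpace μ q' (-s) (delta 1 p)) =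
          conj c * pairing μ f g
        rw [pairing, pairing, ← integral_const_mul]
        refine integral_congr_ae ?_
        filter_upwards [AEEqFun.coeFn_smul c (g : L0 μ)] with z hz
        simp only [Submodule.coe_smul, hz, Pi.smul_apply, smul_eq_mul, map_mul]
        ring }
  have hΦ₀ : ∀ g f, (Φ₀ g : Module.Dual ℂ (tentSpace μ p q s)) f = pairing μ f g := fun _ _ => rfl
  -- The lower bound holds with constant 1; it also yields injectivity.
  have hlower : ∀ g : carlesonSpace μ q' (-s) (delta 1 p),
      carlesonNorm μ q' (-s) (delta 1 p) g ≤ dualNorm (Φ₀ g) := by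
    intro g
    obtain ⟨w, hw, hwpos, hw0, hwT⟩ := exists_pos_eLpNorm_lusin_lt_top μ hp0.ne' hp hq0 hq.ne
    have hwc : Measurable fun z => (w z : ℂ) := Complex.measurable_ofReal.comp hw
    have hwmem : weightedMk μ s (fun z => (w z : ℂ)) hwc ∈ tentSpace μ p q s := by
      change tentNorm μ p q s _ < ∞
      rwa [tentNorm_weightedMk]
    refine carlesonNorm_le_of_forall_pairing hp1 hq1 hq hqq' s hw hwpos hw0 hwT ?_ fun f hf _ => ?_
    -- V^s w lies in the tent space, so its pairing with g converges absolutely; this is the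
    -- required integrability of w · V^s g.
    · refine (hint _ hwmem g g.2).mono
        (hwc.mul (measurable_volPow s (AEEqFun.measurable _))).aestronglyMeasurable ?_
      filter_upwards [ae_halfMeasure_pos μ, volPow_neg_weightedMk s hwc] with z hz hz'
      rw [← volPow_neg_mul_conj_volPow (μ := μ) s _ (g : L0 μ) hz, hz', norm_mul, norm_mul, RCLike.norm_conj]
    · exact enorm_le_dualNorm_mul_tentNorm (Φ₀ g) ⟨f, hf⟩
  have hbij : Function.Bijective Φ₀ := by
    constructor
    · rw [injective_iff_map_eq_zero]
      intro g hg
      have hzero : dualNorm (Φ₀ g) = 0 := by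
        rw [hg]
        simp [dualNorm]
      refine Subtype.ext (eq_zero_of_carlesonNorm_eq_zero (p := p) hq1 hqq' s ?_)
      exact le_antisymm ((hlower g).trans hzero.le) zero_le
    · intro φ
      obtain ⟨g, hg, hφ⟩ := exists_carleson_representation hμ hp0 hp1 hq1 hq hqq' s φ
      exact ⟨⟨g, hg⟩, Subtype.ext (LinearMap.ext fun f => (hφ f).symm)⟩
  refine ⟨LinearEquiv.ofBijective Φ₀ hbij, fun g f => hΦ₀ g f, max C 1, fun g => ⟨?_, ?_⟩⟩
  · refine iSup₂_le fun f hf => ?_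
    refine (hbound f g).trans ?_
    calc (C : ℝ≥0∞) * carlesonNorm μ q' (-s) (delta 1 p) g * tentNorm μ p q s f
        ≤ (max C 1 : ℝ≥0) * carlesonNorm μ q' (-s) (delta 1 p) g * 1 := by
          gcongr
          exact le_max_left _ _
      _ = _ := mul_one _
  · refine (hlower g).trans ?_
    refine le_mul_of_one_le_left zero_le ?_
    exact_mod_cast le_max_right C 1
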